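/- A ReLU network with input dimension $d$ and depth $L$ is given by $n_0=d$, $n_L=1$, hidden layer sizes $n_1,\dots,n_{L-1}$, matrices $W^{(i)}\in\mathbb R^{n_i\times n_{i-1}}$ and biases $b^{(i)}\in\mathbb R^{n_i}$ ($1\le i\le L$). It computes the function $\mathbb R^d\to\mathbb R$, $x\mapsto h^{(L)}$, where $h^{(0)}=x$, $h^{(i)}=\sigma(W^{(i)}h^{(i-1)}+b^{(i)})$ for $1\le i<L$ with $\sigma(z)=\max\{0,z\}$ coordinatewise, and $h^{(L)}=W^{(L)}h^{(L-1)}+b^{(L)}$. Its width is $\max\{d,n_1,\dots,n_{L-1}\}$, its number of parameters is the total number of entries (zero or not) of all $W^{(i)}$ and $b^{(i)}$, and its weights are all these entries. **Theorem.** There is a universal constant $C>0$ such that the following holds. Let $A,B,n,L,d\ge 1$ be integers, $\epsilon,\delta,\beta>0$, and put $\epsilon_0:=\min\{\epsilon,\tfrac12\}$. Let $\mathcal N_0$ be a ReLU network with input dimension $d$, width $n$ (so $d\le n$), depth $L$ and all weights in $[-B,B]$. Let $\mathcal D$ be a probability distribution on $[-A,A]^d$ with a density (with respect to Lebesgue measure)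 that is at most $\beta$ on $[-A,A]^d$. Then there is a ReLU network $\mathcal N$ with input dimension $d$ such that - $\mathcal N$ has width $\max\{5d,10\}$; - $\mathcal N$ has depth at most $C\,n^2L^2\log(ABn/\epsilon_0)$; - $\mathcal N$ has at most $C\,n^2L^2\log(ABn/\epsilon_0)$ parameters; - all weights of $\mathcal N$ have absolute value at most $C\cdot\dfrac{2^{6Ln}\,d^2\,nAB\,\beta\,(2A)^d}{\epsilon_0\,\delta}$; - $\Pr_{x\sim\mathcal D}\big[\,|\mathcal N(x)-\mathcal N_0(x)|\le\epsilon\,\big]>1-\delta$. -/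

import Mathlib

open MeasureTheory
open scoped ENNReal Matrix

/-- A fully connected ReLU network with real output and input dimension `k`: a list of hidden
layers `z ↦ σ (W z + b)` followed by one affine output layer `z ↦ W z + b` with values in `ℝ¹`. -/
inductive ReLUNetwork : ℕ → Type
  /-- the output layer (no activation) -/
  | output {k : ℕ} (W : Matrix (Fin 1) (Fin k) ℝ) (b : Fin 1 → ℝ) : ReLUNetwork k
  /-- a hidden layer with `m` neurons, followed by the remaining layers -/
  | hidden {k m : ℕ} (W : Matrix (Fin m) (Fin k) ℝ) (b : Fin m → ℝ) (rest : ReLUNetwork m) :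
      ReLUNetwork k

namespace ReLUNetwork

/-- The function computed by the network; the activation is `σ z = max 0 z`, coordinatewise. -/
noncomputable def eval : {k : ℕ} → ReLUNetwork k → (Fin k → ℝ) → ℝ
  | _, output W b, x => (W *ᵥ x + b) 0
  | _, hidden W b rest, x => rest.eval (fun i => max 0 ((W *ᵥ x + b) i))

/-- The depth: the number of layers, the output layer included. -/
def depth : {k : ℕ} → ReLUNetwork k → ℕ
  | _, output _ _ => 1
  | _, hidden _ _ rest => rest.depth + 1

/-- The width: the maximum of the input dimension and of the sizes of all hidden layers. -/
def width : {k : ℕ} → ReLUNetwork k → ℕ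
  | k, output _ _ => k
  | k, hidden _ _ rest => max k rest.width

/-- The number of parameters: the total number of entries (zero or not) of all weight matrices
and bias vectors. -/
def numParams : {k : ℕ} → ReLUNetwork k → ℕ
  | k, output _ _ => 1 * k + 1
  | k, hidden (m := m) _ _ rest => m * k + m + rest.numParams

/-- All weights, that is all entries of weight matrices and bias vectors, lie in `[-M, M]`. -/
def WeightsBoundedBy (M : ℝ) : {k : ℕ} → ReLUNetwork k → Prop
  | _, output W b => (∀ i j, |W i j| ≤ M) ∧ ∀ i, |b i| ≤ M
  | _, hidden W b rest => (∀ i j, |W i j| ≤ M) ∧ (∀ i, |b i| ≤ M) ∧ rest.WeightsBoundedBy M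

end ReLUNetwork

/-- The cube `[-A, A]^d`. -/
def centeredCube (d : ℕ) (A : ℝ) : Set (Fin d → ℝ) :=
  Set.Icc (fun _ => -A) (fun _ => A)

/-!
Width is traded for depth by holding all intermediate values in a few registers. A deep network of
constant width can treat its neurons as registers and its layers as instructions; the difficulty is
that the `n` activations of a layer of the given network must be remembered, and that ReLU layers
are continuous maps with weights of limited size.

The activations are therefore rounded to `T` binary digits, and the digits of all activations of
a layer are stored in one real number, as a stack of bits whose base-`4` digits are `1` and `3`
(`pushBits`, `stack`). The gaps of this Cantor set make it possible to pop a bit exactly with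
bounded weights (`computes_popBit`), so a scalar product with the stored values costs `O(T)` layers
per value (`computes_dot`). The new activation is then an integer in binary, since the weights are
rounded too, and it has to be converted into the stack encoding. Its bits are found by comparison
with a threshold that is halved in each step; instead of subtracting the threshold, which would
need steep slopes, the remainder is reflected at it, and the orientation is tracked in one further
register (`computes_extractBit`). A neuron of the given network thus costs `O(n * T)` layers of
width at most `10`, and the whole network costs `O(n ^ 2 * L * T)` layers
(`ReLUNetwork.exists_simulation`).

Rounding errors and magnitudes grow by a factor `2 ^ r` of order `n ^ 2 * A * B` per layer
(`fixedPointNeuron_spec`), so that `T = O(L * log (A * B * n / ε))` digits suffice. All values are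
normalized to `[0, 1)`; large powers of two arise only by repeated doubling and never as weights.

Only the digits of the real input cannot be read exactly everywhere. They are read for all
coordinates in parallel, within width `4 * d`, by ramps of slope `s`
(`computes_readBit`). A digit is misread only on intervals of relative length `1 / s`, and the bound
on the density turns this into a failure probability below `δ` (`lt_measureReal_of_readable`), for
a slope that the bound on the weights allows (`weight_estimates`).
-/

/-! ### Register programs -/

/-- The register `g` is the output of one ReLU neuron, with weights and bias in `[-M, M]`, that
reads the registers `φ`. Registers are real functions on a set `X` of inputs. -/
def IsNeuron {X κ : Type} [Fintype κ] (M : ℝ) (φ : X → κ → ℝ) (g : X → ℝ) : Prop :=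
  ∃ (w : κ → ℝ) (b : ℝ), (∀ j, |w j| ≤ M) ∧ |b| ≤ M ∧
    ∀ x, g x = max 0 (∑ j, w j * φ x j + b)

/-- One hidden layer with weights in `[-M, M]` takes the registers `φ` to the registers `ψ`, for
all inputs in `X` simultaneously. -/
def LayerTo {X κ l : Type} [Fintype κ] (M : ℝ) (φ : X → κ → ℝ) (ψ : X → l → ℝ) : Prop :=
  ∀ i, IsNeuron M φ (fun x => ψ x i)

/-- `Computes M w φ D ψ`: some sequence of `D` hidden layers, of at most `w` neurons each and with
weights in `[-M, M]`, takes the registers `φ` to the registers `ψ`. Layers are indexed by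
arbitrary finite types, so that programs can be run side by side on a sum or a product of
index types. -/
inductive Computes {X : Type} (M : ℝ) (w : ℕ) {κ : Type} [Fintype κ] (φ : X → κ → ℝ) :
    ∀ {l : Type} [Fintype l], ℕ → (X → l → ℝ) → Prop
  | refl : Computes M w φ 0 φ
  | step {l l' : Type} [Fintype l] [Fintype l'] {D : ℕ} {ψ : X → l → ℝ} {χ : X → l' → ℝ}
      (h : Computes M w φ D ψ) (hc : Fintype.card l' ≤ w) (hl : LayerTo M ψ χ) :
      Computes M w φ (D + 1) χ

section Programs

variable {X κ l l' : Type} [Fintype κ] [Fintype l] [Fintype l'] {M : ℝ} {w w' : ℕ}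

theorem LayerTo.computes {φ : X → κ → ℝ} {ψ : X → l → ℝ} (h : LayerTo M φ ψ)
    (hc : Fintype.card l ≤ w) : Computes M w φ 1 ψ :=
  Computes.step Computes.refl hc h

theorem Computes.trans {φ : X → κ → ℝ} {ψ : X → l → ℝ} {χ : X → l' → ℝ} {D D' : ℕ}
    (h : Computes M w φ D ψ) (h' : Computes M w ψ D' χ) : Computes M w φ (D + D') χ := by
  induction h' with
  | refl => exact h
  | step _ hc hl ih => exact Computes.step ih hc hl

theorem Computes.mono_width {φ : X → κ → ℝ} {ψ : X → l → ℝ} {D : ℕ}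
    (h : Computes M w φ D ψ) (hw : w ≤ w') : Computes M w' φ D ψ := by
  induction h with
  | refl => exact Computes.refl
  | step _ hc hl ih => exact Computes.step ih (hc.trans hw) hl

theorem Computes.iterate {c : ℕ} (st : ℕ → X → κ → ℝ) (n : ℕ)
    (h : ∀ j < n, Computes M w (st j) c (st (j + 1))) : Computes M w (st 0) (n * c) (st n) := by
  induction n with
  | zero => simpa using Computes.refl
  | succ n ih =>
    rw [add_mul, one_mul]
    exact (ih fun j hj => h j (hj.trans n.lt_succ_self)).trans (h n n.lt_succ_self)

theorem isNeuron_of_nonneg {φ : X → κ → ℝ} {g : X → ℝ} (hg : ∀ x, 0 ≤ g x) (w : κ → ℝ) (b : ℝ)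
    (hw : ∀ j, |w j| ≤ M) (hb : |b| ≤ M) (h : ∀ x, g x = ∑ j, w j * φ x j + b) :
    IsNeuron M φ g :=
  ⟨w, b, hw, hb, fun x => by rw [← h, max_eq_right (hg x)]⟩

theorem isNeuron_coord {φ : X → κ → ℝ} (hM : 1 ≤ M) (j : κ) (h0 : ∀ x, 0 ≤ φ x j) :
    IsNeuron M φ (fun x => φ x j) := by
  classical
  refine ⟨fun i => if i = j then 1 else 0, 0, fun i => ?_, by simp; linarith, fun x => ?_⟩
  · dsimp only
    split_ifs <;> simp <;> linarith
  · simp [h0 x]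

/-- Registers with nonnegative values can be copied, dropped and reordered by one layer. -/
theorem Computes.copy {φ : X → κ → ℝ} {ψ : X → l → ℝ} (hM : 1 ≤ M) (hc : Fintype.card l ≤ w)
    (σ : l → κ) (h : ∀ x i, ψ x i = φ x (σ i)) (h0 : ∀ x i, 0 ≤ ψ x i) :
    Computes M w φ 1 ψ := by
  refine LayerTo.computes (fun i => ?_) hc
  have := isNeuron_coord (φ := φ) hM (σ i) (fun x => by rw [← h]; exact h0 x i)
  simpa only [h] using this

/-- Nonnegative registers `f` can be carried along unchanged by any program. -/
theorem Computes.frame {F : Type} [Fintype F] {φ : X → κ → ℝ} {ψ : X → l → ℝ} {D : ℕ}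
    (h : Computes M w φ D ψ) (hM : 1 ≤ M) (f : X → F → ℝ) (hf : ∀ x i, 0 ≤ f x i)
    (hw : w + Fintype.card F ≤ w') :
    Computes M w' (fun x => Sum.elim (φ x) (f x)) D (fun x => Sum.elim (ψ x) (f x)) := by
  induction h with
  | refl => exact Computes.refl
  | step _ hc hl ih =>
    refine Computes.step ih (by rw [Fintype.card_sum]; omega) ?_
    rintro (i | i)
    · obtain ⟨v, b, hv, hb, he⟩ := hl i
      refine ⟨Sum.elim v 0, b, ?_, hb, fun x => ?_⟩
      · rintro (j | j)
        · exact hv j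
        · simp; linarith
      · simpa [Fintype.sum_sum_type] using he x
    · exact isNeuron_coord hM (Sum.inr i) (fun x => hf x i)

/-- The same program can be run in parallel on finitely many data `f i x`. -/
theorem Computes.parallel {Y I : Type} [Fintype I] {φ : Y → κ → ℝ} {ψ : Y → l → ℝ} {D : ℕ}
    (h : Computes M w φ D ψ) (hM : 0 ≤ M) (f : I → X → Y) (hw : Fintype.card I * w ≤ w') :
    Computes M w' (fun x (p : I × κ) => φ (f p.1 x) p.2) D
      (fun x (p : I × l) => ψ (f p.1 x) p.2) := by
  classical
  induction h with
  | refl => exact Computes.refl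
  | step _ hc hl ih =>
    refine Computes.step ih ?_ ?_
    · rw [Fintype.card_prod]
      exact (Nat.mul_le_mul_left _ hc).trans hw
    · rintro ⟨i, k⟩
      obtain ⟨v, b, hv, hb, he⟩ := hl k
      refine ⟨fun p => if p.1 = i then v p.2 else 0, b, ?_, hb, fun x => ?_⟩
      · rintro ⟨i', k'⟩
        dsimp only
        split_ifs
        · exact hv k'
        · simpa using hM
      · rw [Fintype.sum_prod_type, Finset.sum_eq_single i]
        · simpa using he (f i x)
        · intro i' _ hi'
          simp [hi']
        · simp

/-- Multiplication by `2 ^ k` with bounded weights. -/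
theorem Computes.double {φ : X → κ → ℝ} (hM : 2 ≤ M) (hc : Fintype.card κ ≤ w)
    (h0 : ∀ x i, 0 ≤ φ x i) (k : ℕ) : Computes M w φ k (fun x i => 2 ^ k * φ x i) := by
  classical
  have := Computes.iterate (M := M) (w := w) (c := 1) (fun j x i => 2 ^ j * φ x i) k
    (fun j _ => LayerTo.computes (fun i => ?_) hc)
  · simpa using this
  · refine ⟨fun i' => if i' = i then 2 else 0, 0, fun i' => ?_, by simp; linarith, fun x => ?_⟩
    · dsimp only
      split_ifs <;> simp <;> linarith
    · have : 0 ≤ 2 * (2 ^ j * φ x i) := by have := h0 x i; positivity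
      simp only [ite_mul, zero_mul, Finset.sum_ite_eq', Finset.mem_univ, if_true, add_zero,
        max_eq_right this]
      ring

/-- A program can be prefixed to a network. -/
theorem Computes.exists_network {φ : X → κ → ℝ} {ψ : X → l → ℝ} {D : ℕ}
    (h : Computes M w φ D ψ) (hκ : Fintype.card κ ≤ w)
    (rest : ReLUNetwork (Fintype.card l)) (hrest : rest.WeightsBoundedBy M) :
    ∃ N : ReLUNetwork (Fintype.card κ), N.depth = D + rest.depth ∧ N.WeightsBoundedBy M ∧
      N.width ≤ max w rest.width ∧ N.numParams ≤ D * (w * w + w) + rest.numParams ∧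
      ∀ x, N.eval (φ x ∘ (Fintype.equivFin κ).symm) =
        rest.eval (ψ x ∘ (Fintype.equivFin l).symm) := by
  induction h with
  | refl => exact ⟨rest, by simp, hrest, le_max_right _ _, by simp, fun x => rfl⟩
  | @step l₁ l₂ _ _ D ψ χ h hc hl ih =>
    choose v b hv hb he using hl
    have hl₁ : Fintype.card l₁ ≤ w := by
      cases h with
      | refl => exact hκ
      | step _ hc _ => exact hc
    obtain ⟨N, hd, hN, hwid, hpar, hev⟩ := ih
      (ReLUNetwork.hidden
        (fun i j => v ((Fintype.equivFin l₂).symm i) ((Fintype.equivFin l₁).symm j))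
        (fun i => b ((Fintype.equivFin l₂).symm i)) rest)
      ⟨fun i j => hv _ _, fun i => hb _, hrest⟩
    refine ⟨N, ?_, hN, ?_, ?_, fun x => ?_⟩
    · rw [hd]
      change D + (rest.depth + 1) = _
      ring
    · change N.width ≤ max w (max (Fintype.card l₁) rest.width) at hwid
      refine hwid.trans (max_le (le_max_left _ _) (max_le (hl₁.trans (le_max_left _ _))
        (le_max_right _ _)))
    · change N.numParams ≤ D * (w * w + w) + (Fintype.card l₂ * Fintype.card l₁ +
        Fintype.card l₂ + rest.numParams) at hpar
      have h1 : Fintype.card l₂ * Fintype.card l₁ ≤ w * w := Nat.mul_le_mul hc hl₁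
      calc N.numParams ≤ _ := hpar
        _ ≤ D * (w * w + w) + (w * w + w + rest.numParams) := by gcongr
        _ = _ := by ring
    · rw [hev]
      change rest.eval _ = _
      congr 1
      funext i
      simp only [Function.comp, he, Matrix.mulVec, dotProduct, Pi.add_apply]
      rw [← Equiv.sum_comp (Fintype.equivFin l₁).symm]

end Programs

/-! ### Stacks of bits -/

/-- The stack `c` after pushing the `T` lowest binary digits of `H`, the highest of them first.
A stack of bits is a number in `[0, 1)` whose base-`4` digits are `1` and `3`. The gaps of this
Cantor set are what allows a ReLU layer with bounded weights to read the top bit exactly. -/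
noncomputable def pushBits : ℕ → ℕ → ℝ → ℝ
  | 0, _, c => c
  | T + 1, H, c => (1 + 2 * ((H % 2 : ℕ) : ℝ) + pushBits T (H / 2) c) / 4

theorem pushBits_mem (T H : ℕ) {c : ℝ} (hc : 0 ≤ c ∧ c < 1) :
    0 ≤ pushBits T H c ∧ pushBits T H c < 1 := by
  induction T generalizing H with
  | zero => exact hc
  | succ T ih =>
    have h1 := ih (H / 2)
    have h2 : ((H % 2 : ℕ) : ℝ) ≤ 1 := by
      exact_mod_cast Nat.le_of_lt_succ (Nat.mod_lt H two_pos)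
    have h3 : (0 : ℝ) ≤ ((H % 2 : ℕ) : ℝ) := Nat.cast_nonneg _
    constructor <;> rw [pushBits] <;> linarith [h1.1, h1.2]

theorem pushBits_add (a b H : ℕ) (c : ℝ) :
    pushBits (a + b) H c = pushBits a H (pushBits b (H / 2 ^ a) c) := by
  induction a generalizing H with
  | zero => simp [pushBits]
  | succ a ih =>
    rw [Nat.add_right_comm, pushBits, pushBits, ih, Nat.div_div_eq_div_mul, pow_succ']

theorem pushBits_eq_add (T H : ℕ) (c : ℝ) : pushBits T H c = pushBits T H 0 + c / 4 ^ T := by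
  induction T generalizing H with
  | zero => simp [pushBits]
  | succ T ih =>
    rw [pushBits, pushBits, ih, pow_succ]
    field_simp
    ring

/-- The stack that holds the first `k` values of `G`, with `T` bits each and the last value on
top. -/
noncomputable def stack (T : ℕ) (G : ℕ → ℕ) : ℕ → ℝ
  | 0 => 0
  | k + 1 => pushBits T (G k) (stack T G k)

theorem stack_mem (T : ℕ) (G : ℕ → ℕ) (k : ℕ) : 0 ≤ stack T G k ∧ stack T G k < 1 := by
  induction k with
  | zero => simp [stack]
  | succ k ih => exact pushBits_mem _ _ ih

theorem stack_eq_sum (T : ℕ) (G : ℕ → ℕ) (k : ℕ) :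
    stack T G k = ∑ i ∈ Finset.range k, 1 / (4 ^ T) ^ (k - 1 - i) * pushBits T (G i) 0 := by
  induction k with
  | zero => simp [stack]
  | succ k ih =>
    rw [stack, pushBits_eq_add, ih, Finset.sum_range_succ, Finset.sum_div, add_comm]
    congr 1
    · refine Finset.sum_congr rfl fun i hi => ?_
      rw [Finset.mem_range] at hi
      rw [show k + 1 - 1 - i = (k - 1 - i) + 1 by omega, pow_succ]
      field_simp
    · simp

section Decoding

variable {X : Type} {M : ℝ}

/-- Popping one bit `b` and shifting it into the register `v` from above. -/
theorem computes_popBit (hM : 4 ≤ M) (b : X → ℕ) (c v : X → ℝ) (hb : ∀ x, b x < 2)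
    (hc : ∀ x, 0 ≤ c x ∧ c x < 1) (hv : ∀ x, 0 ≤ v x) :
    Computes M 4 (fun x => ![(1 + 2 * (b x : ℝ) + c x) / 4, v x]) 2
      (fun x => ![c x, (v x + b x) / 2]) := by
  have hb' : ∀ x, (b x : ℝ) = 0 ∨ (b x : ℝ) = 1 := fun x => by
    have := hb x
    interval_cases h : b x <;> simp
  refine Computes.trans (D := 1) (D' := 1) (ψ := fun x => ![(1 + 2 * (b x : ℝ) + c x) / 4,
    max 0 (2 * b x + c x - 1), max 0 (2 * b x + c x - 2), v x])
    (LayerTo.computes ?_ (by simp)) (LayerTo.computes ?_ (by simp))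
  · intro i
    fin_cases i
    · refine ⟨![1, 0], 0, ?_, by simp; linarith, fun x => ?_⟩
      · intro j; fin_cases j <;> simp <;> linarith
      · have : 0 ≤ (1 + 2 * (b x : ℝ) + c x) / 4 := by have := (hc x).1; positivity
        simp [this]
    · refine ⟨![4, 0], -2, ?_, by norm_num; linarith, fun x => ?_⟩
      · intro j; fin_cases j <;> simp <;> linarith
      · simp [Fin.sum_univ_two]; congr 1; ring
    · refine ⟨![4, 0], -3, ?_, by norm_num; linarith, fun x => ?_⟩
      · intro j; fin_cases j <;> simp <;> linarith
      · simp [Fin.sum_univ_two]; congr 1; ring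
    · refine ⟨![0, 1], 0, ?_, by simp; linarith, fun x => ?_⟩
      · intro j; fin_cases j <;> simp <;> linarith
      · simp [hv x]
  · have hb1 : ∀ x, max 0 (2 * (b x : ℝ) + c x - 1) - max 0 (2 * b x + c x - 2) = b x := fun x => by
      obtain ⟨h0, h1⟩ := hc x
      rcases hb' x with h | h <;> rw [h]
      · rw [max_eq_left (by linarith), max_eq_left (by linarith), sub_zero]
      · rw [max_eq_right (by linarith), max_eq_right (by linarith)]; ring
    intro i
    fin_cases i
    · refine isNeuron_of_nonneg (fun x => (hc x).1) ![4, -2, 2, 0] (-1) ?_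
        (by norm_num; linarith) (fun x => ?_)
      · intro j; fin_cases j <;> simp <;> linarith
      · simp [Fin.sum_univ_four]; linarith [hb1 x]
    · refine isNeuron_of_nonneg (fun x => ?_) ![0, 1 / 2, -1 / 2, 1 / 2] 0 ?_
        (by norm_num; linarith) (fun x => ?_)
      · have := hv x
        simp only [Fin.mk_one, Matrix.cons_val_one, Matrix.cons_val_fin_one]
        positivity
      · intro j; fin_cases j <;> norm_num [abs_le] <;> linarith
      · simp [Fin.sum_univ_four]; linarith [hb1 x]

/-- Popping a value of `T` bits, the lowest first; it arrives scaled by `2 ^ (-T)`. -/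
theorem computes_popValue (hM : 4 ≤ M) (T : ℕ) (H : X → ℕ) (c v : X → ℝ)
    (hH : ∀ x, H x < 2 ^ T) (hc : ∀ x, 0 ≤ c x ∧ c x < 1) (hv : ∀ x, 0 ≤ v x) :
    Computes M 4 (fun x => ![pushBits T (H x) (c x), v x]) (2 * T)
      (fun x => ![c x, (v x + H x) / 2 ^ T]) := by
  induction T generalizing H v with
  | zero =>
    have h0 : ∀ x, H x = 0 := fun x => by simpa using hH x
    simpa [pushBits, h0] using Computes.refl
  | succ T ih =>
    have h1 := computes_popBit hM (fun x => H x % 2) (fun x => pushBits T (H x / 2) (c x)) v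
      (fun x => Nat.mod_lt _ two_pos) (fun x => pushBits_mem _ _ (hc x)) hv
    have h2 := ih (fun x => H x / 2) (fun x => (v x + ((H x % 2 : ℕ) : ℝ)) / 2)
      (fun x => by have := hH x; rw [pow_succ] at this; omega)
      (fun x => by have := hv x; positivity)
    have h3 := h1.trans h2
    rw [show 2 * (T + 1) = 2 + 2 * T by ring]
    have h4 : ∀ x, (v x + H x) / 2 ^ (T + 1) =
        ((v x + ((H x % 2 : ℕ) : ℝ)) / 2 + ((H x / 2 : ℕ) : ℝ)) / 2 ^ T := fun x => by
      have h5 : (H x : ℝ) = ((H x % 2 : ℕ) : ℝ) + 2 * ((H x / 2 : ℕ) : ℝ) := by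
        exact_mod_cast (Nat.mod_add_div (H x) 2).symm
      rw [h5, pow_succ]
      field_simp
      ring
    simp only [h4]
    exact h3

/-- A scalar product with the values on a stack. The contributions of the positive and of the
negative weights are collected in two registers, since registers are nonnegative. -/
theorem computes_dot (hM : 4 ≤ M) (T k : ℕ) (G : X → ℕ → ℕ) (p n : X → ℝ) (w : ℕ → ℝ)
    (hG : ∀ x, ∀ i < k, G x i < 2 ^ T) (hw : ∀ i < k, |w i| ≤ M)
    (hp : ∀ x, 0 ≤ p x) (hn : ∀ x, 0 ≤ n x) :
    Computes M 6 (fun x => ![stack T (G x) k, p x, n x]) (k * (2 * T + 2))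
      (fun x => ![0, p x + ∑ i ∈ Finset.range k, max 0 (w i) * (G x i / 2 ^ T),
        n x + ∑ i ∈ Finset.range k, max 0 (-w i) * (G x i / 2 ^ T)]) := by
  induction k generalizing p n with
  | zero => simpa [stack] using Computes.refl
  | succ k ih =>
    have hwk := hw k k.lt_succ_self
    rw [abs_le] at hwk
    have s := fun x => stack_mem T (G x) k
    have s' := fun x => stack_mem T (G x) (k + 1)
    have v0 : ∀ x, (0 : ℝ) ≤ G x k / 2 ^ T := fun x => by positivity
    have h1 : Computes M 6 (fun x => ![stack T (G x) (k + 1), p x, n x]) 1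
        (fun x => Sum.elim ![pushBits T (G x k) (stack T (G x) k), 0] ![p x, n x]) := by
      refine LayerTo.computes ?_ (by simp)
      rintro (i | i) <;> fin_cases i
      · exact isNeuron_coord (by linarith) (0 : Fin 3) (fun x => (s' x).1)
      · exact ⟨0, 0, by simp; linarith, by simp; linarith, by simp⟩
      · exact isNeuron_coord (by linarith) (1 : Fin 3) hp
      · exact isNeuron_coord (by linarith) (2 : Fin 3) hn
    have h2 := (computes_popValue hM T (fun x => G x k) (fun x => stack T (G x) k) (fun _ => 0)
      (fun x => hG x k k.lt_succ_self) s (fun _ => le_rfl)).frame (w' := 6) (by linarith)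
      (fun x => ![p x, n x]) (fun x i => by fin_cases i; exacts [hp x, hn x]) (by simp)
    have h3 : ∀ a b : ℝ, 0 ≤ a ∧ a ≤ M → 0 ≤ b ∧ b ≤ M →
        Computes M 6 (fun x => Sum.elim ![stack T (G x) k, (0 + G x k) / 2 ^ T] ![p x, n x]) 1
        (fun x => ![stack T (G x) k, p x + a * (G x k / 2 ^ T), n x + b * (G x k / 2 ^ T)]) := by
      intro a b ha hb
      refine LayerTo.computes ?_ (by simp)
      intro i
      fin_cases i
      · exact isNeuron_coord (by linarith) (Sum.inl 0 : Fin 2 ⊕ Fin 2) (fun x => (s x).1)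
      · refine isNeuron_of_nonneg (fun x => add_nonneg (hp x) (mul_nonneg ha.1 (v0 x)))
          (Sum.elim ![0, a] ![1, 0]) 0 ?_ (by simp; linarith) (fun x => ?_)
        · rintro (j | j) <;> fin_cases j <;> simp [abs_of_nonneg ha.1] <;> linarith
        · simp [Fin.sum_univ_two]; ring
      · refine isNeuron_of_nonneg (fun x => add_nonneg (hn x) (mul_nonneg hb.1 (v0 x)))
          (Sum.elim ![0, b] ![0, 1]) 0 ?_ (by simp; linarith) (fun x => ?_)
        · rintro (j | j) <;> fin_cases j <;> simp [abs_of_nonneg hb.1] <;> linarith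
        · simp [Fin.sum_univ_two]; ring
    replace h3 := h3 (max 0 (w k)) (max 0 (-w k))
      ⟨le_max_left _ _, max_le (by linarith) hwk.2⟩
      ⟨le_max_left _ _, max_le (by linarith) (by linarith)⟩
    have h4 := ih (fun x => p x + max 0 (w k) * (G x k / 2 ^ T))
      (fun x => n x + max 0 (-w k) * (G x k / 2 ^ T))
      (fun x i hi => hG x i (hi.trans k.lt_succ_self)) (fun i hi => hw i (hi.trans k.lt_succ_self))
      (fun x => add_nonneg (hp x) (mul_nonneg (le_max_left _ _) (v0 x)))
      (fun x => add_nonneg (hn x) (mul_nonneg (le_max_left _ _) (v0 x)))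
    rw [show (k + 1) * (2 * T + 2) = 1 + 2 * T + 1 + k * (2 * T + 2) by ring]
    convert ((h1.trans h2).trans h3).trans h4 using 1
    funext x
    rw [Finset.sum_range_succ, Finset.sum_range_succ]
    congr 2
    · ring
    · congr 1
      ring

end Decoding

/-! ### Extracting the bits of an integer -/

section Encoding

variable {X : Type} {M : ℝ}

/-- One step of the conversion of an integer `V < 2 * G` into bits. The remainder modulo the
threshold `G` has slope of order `G`, too steep for bounded weights. Instead, the first
register is reflected at `G`; it then holds either `V` or `2 * G - 1 - V`, and the register `p`
records which. The bit of `V` is the exclusive or of `p` and the outcome of the comparison. -/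
theorem computes_extractBit (hM : 4 ≤ M) (G : ℝ) (b p V V' : X → ℝ) (D : X → ℝ) (hG : 1 ≤ G)
    (hp : ∀ x, p x = 0 ∨ p x = 1) (hb : ∀ x, b x = 0 ∨ b x = 1)
    (hV : ∀ x, V x = G * b x + V' x) (hV0 : ∀ x, 0 ≤ V' x) (hV1 : ∀ x, V' x + 1 ≤ G)
    (hD : ∀ x, 0 ≤ D x) :
    Computes M 7 (fun x => ![V x + p x * (2 * G - 1 - 2 * V x), G, p x, D x]) 3
      (fun x => ![V' x + b x * (G - 1 - 2 * V' x), G / 2, b x, (1 + 2 * b x + D x) / 4]) := by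
  set Y : X → ℝ := fun x => V x + p x * (2 * G - 1 - 2 * V x) with hY
  have hp0 : ∀ x, 0 ≤ p x := fun x => by rcases hp x with h | h <;> rw [h]; norm_num
  have hb0 : ∀ x, 0 ≤ b x := fun x => by rcases hb x with h | h <;> rw [h]; norm_num
  have hY0 : ∀ x, 0 ≤ Y x := fun x => by
    have e := hV x; have := hV0 x; have := hV1 x
    simp only [hY]
    rcases hp x with h | h <;> rcases hb x with h' | h' <;> rw [h] <;> rw [h'] at e <;> linarith
  have hR0 : ∀ x, 0 ≤ V' x + b x * (G - 1 - 2 * V' x) := fun x => by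
    have := hV0 x; have := hV1 x
    rcases hb x with h' | h' <;> rw [h'] <;> linarith
  -- The comparison bit differs from `p` exactly if the bit `b` is set.
  have key : ∀ x, (max 0 (Y x - G + 1) - max 0 (Y x - G) = p x + b x - 2 * (p x * b x)) ∧
      Y x - 2 * max 0 (Y x - G + 1 / 2) = V' x + b x * (G - 1 - 2 * V' x) := fun x => by
    have e := hV x; have := hV0 x; have := hV1 x
    have hYx : Y x = V x + p x * (2 * G - 1 - 2 * V x) := rfl
    rcases hp x with h | h <;> rcases hb x with h' | h' <;> rw [h'] at e <;> rw [h] at hYx <;>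
    rw [h, h'] <;>
    first
    | rw [max_eq_left (by linarith), max_eq_left (by linarith), max_eq_left (by linarith)]
      constructor <;> linarith
    | rw [max_eq_right (by linarith), max_eq_right (by linarith), max_eq_right (by linarith)]
      constructor <;> linarith
  have hxor : ∀ x, p x + (p x + b x - 2 * (p x * b x)) -
      2 * max 0 (p x + (p x + b x - 2 * (p x * b x)) - 1) = b x := fun x => by
    rcases hp x with h | h <;> rcases hb x with h' | h' <;> rw [h, h'] <;> norm_num
  have hsum : ∀ x, 0 ≤ p x + (p x + b x - 2 * (p x * b x)) := fun x => by
    rcases hp x with h | h <;> rcases hb x with h' | h' <;> rw [h, h'] <;> norm_num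
  -- `G` may exceed the bound for the weights, hence it is read from a register, not from a bias.
  have h1 : Computes M 7 (fun x => ![Y x, G, p x, D x]) 1
      (fun x => ![Y x, G, p x, D x, max 0 (Y x - G + 1), max 0 (Y x - G),
        max 0 (Y x - G + 1 / 2)]) := by
    refine LayerTo.computes (fun i => ?_) (by simp)
    fin_cases i
    · exact isNeuron_coord (by linarith) (0 : Fin 4) hY0
    · exact isNeuron_coord (by linarith) (1 : Fin 4) (fun x => by simp; linarith)
    · exact isNeuron_coord (by linarith) (2 : Fin 4) hp0
    · exact isNeuron_coord (by linarith) (3 : Fin 4) hD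
    · refine ⟨![1, -1, 0, 0], 1, ?_, by norm_num; linarith, fun x => ?_⟩
      · intro j; fin_cases j <;> simp <;> linarith
      · simp [Fin.sum_univ_four]; congr 1
    · refine ⟨![1, -1, 0, 0], 0, ?_, by norm_num; linarith, fun x => ?_⟩
      · intro j; fin_cases j <;> simp <;> linarith
      · simp [Fin.sum_univ_four]; congr 1
    · refine ⟨![1, -1, 0, 0], 1 / 2, ?_, by norm_num [abs_le]; linarith, fun x => ?_⟩
      · intro j; fin_cases j <;> simp <;> linarith
      · simp [Fin.sum_univ_four]; congr 1
  have h2 : Computes M 7 (fun x => ![Y x, G, p x, D x, max 0 (Y x - G + 1), max 0 (Y x - G),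
        max 0 (Y x - G + 1 / 2)]) 1
      (fun x => ![V' x + b x * (G - 1 - 2 * V' x), G / 2,
        p x + (p x + b x - 2 * (p x * b x)),
        max 0 (p x + (p x + b x - 2 * (p x * b x)) - 1), D x]) := by
    refine LayerTo.computes (fun i => ?_) (by simp)
    fin_cases i
    · refine isNeuron_of_nonneg hR0 ![1, 0, 0, 0, 0, 0, -2] 0 ?_ (by norm_num; linarith)
        (fun x => ?_)
      · intro j; fin_cases j <;> simp <;> linarith
      · simp [Fin.sum_univ_succ]; linarith [(key x).2]
    · refine isNeuron_of_nonneg (fun x => by simp; linarith) ![0, 1 / 2, 0, 0, 0, 0, 0] 0 ?_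
        (by norm_num; linarith) (fun x => ?_)
      · intro j; fin_cases j <;> norm_num [abs_le] <;> linarith
      · simp [Fin.sum_univ_succ]; linarith
    · refine isNeuron_of_nonneg hsum ![0, 0, 1, 0, 1, -1, 0] 0 ?_ (by norm_num; linarith)
        (fun x => ?_)
      · intro j; fin_cases j <;> simp <;> linarith
      · simp [Fin.sum_univ_succ]; linarith [(key x).1]
    · refine ⟨![0, 0, 1, 0, 1, -1, 0], -1, ?_, by norm_num; linarith, fun x => ?_⟩
      · intro j; fin_cases j <;> simp <;> linarith
      · have : p x + (p x + b x - 2 * (p x * b x)) - 1 =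
            p x + (max 0 (Y x - G + 1) - max 0 (Y x - G)) - 1 := by rw [(key x).1]
        simp only [this]
        simp [Fin.sum_univ_succ]; congr 1
    · exact isNeuron_coord (by linarith) (3 : Fin 7) hD
  refine (h1.trans h2).trans (LayerTo.computes (fun i => ?_) (by simp))
  fin_cases i
  · exact isNeuron_coord (by linarith) (0 : Fin 5) hR0
  · exact isNeuron_coord (by linarith) (1 : Fin 5) (fun x => by simp; linarith)
  · refine isNeuron_of_nonneg hb0 ![0, 0, 1, -2, 0] 0 ?_ (by norm_num; linarith) (fun x => ?_)
    · intro j; fin_cases j <;> simp <;> linarith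
    · simp [Fin.sum_univ_succ]; linarith [hxor x]
  · refine isNeuron_of_nonneg (fun x => ?_) ![0, 0, 1 / 2, -1, 1 / 4] (1 / 4) ?_
      (by norm_num [abs_le]; linarith) (fun x => ?_)
    · have := hb0 x; have := hD x
      simp
      positivity
    · intro j; fin_cases j <;> norm_num [abs_le] <;> linarith
    · simp [Fin.sum_univ_succ]; linarith [hxor x]

/-- Pushing the `t` highest of the `k + t` bits of an integer `V` onto a stack. -/
theorem computes_extract (hM : 4 ≤ M) (k t : ℕ) (V : X → ℕ) (D : X → ℝ)
    (hV : ∀ x, V x < 2 ^ (k + t)) (hD : ∀ x, 0 ≤ D x ∧ D x < 1) :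
    ∃ f g h : X → ℝ, Computes M 7 (fun x => ![(V x : ℝ), 2 ^ (k + t) / 2, 0, D x]) (t * 3)
      (fun x => ![f x, g x, h x, pushBits t (V x / 2 ^ k) (D x)]) := by
  let B : ℕ → X → ℕ := fun j x => V x % 2 ^ (k + t + 1 - j) / 2 ^ (k + t - j)
  let R : ℕ → X → ℕ := fun j x => V x % 2 ^ (k + t - j)
  let st : ℕ → X → Fin 4 → ℝ := fun j x =>
    ![(R j x : ℝ) + B j x * (2 ^ (k + t - j) - 1 - 2 * R j x), 2 ^ (k + t - j) / 2, B j x,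
      pushBits j (V x / 2 ^ (k + t - j)) (D x)]
  have hB : ∀ j x, B j x < 2 := fun j x => by
    apply Nat.div_lt_of_lt_mul
    refine (Nat.mod_lt _ (by positivity)).trans_le ?_
    rw [mul_comm, ← pow_succ']
    exact Nat.pow_le_pow_right two_pos (by omega)
  have hB' : ∀ j x, (B j x : ℝ) = 0 ∨ (B j x : ℝ) = 1 := fun j x => by
    have := hB j x
    interval_cases h : B j x <;> simp
  have main := Computes.iterate (M := M) (w := 7) (c := 3) st t (fun j hj => by
    obtain ⟨m, hm⟩ : ∃ m, k + t - j = m + 1 := ⟨k + t - j - 1, by omega⟩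
    have hm' : k + t - (j + 1) = m := by omega
    have hm'' : k + t + 1 - (j + 1) = m + 1 := by omega
    have h1 := computes_extractBit hM (2 ^ m) (fun x => (B (j + 1) x : ℝ)) (fun x => (B j x : ℝ))
      (fun x => (R j x : ℝ)) (fun x => (R (j + 1) x : ℝ))
      (fun x => pushBits j (V x / 2 ^ (m + 1)) (D x)) (one_le_pow₀ one_le_two)
      (hB' j) (hB' (j + 1)) (fun x => by
        simp only [R, B, hm, hm', hm'']
        have h2 : V x % 2 ^ m = V x % 2 ^ (m + 1) % 2 ^ m :=
          (Nat.mod_mod_of_dvd _ (pow_dvd_pow _ m.le_succ)).symm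
        rw [h2]
        exact_mod_cast (Nat.div_add_mod _ _).symm)
      (fun x => Nat.cast_nonneg _) (fun x => by
        simp only [R, hm']
        exact_mod_cast Nat.mod_lt (V x) (by positivity)) (fun x => (pushBits_mem _ _ (hD x)).1)
    convert h1 using 1
    · funext x
      simp only [st, hm]
      rw [pow_succ]
      congr 2
      · ring
      · ring
    · funext x
      have h3 : V x / 2 ^ m % 2 = B (j + 1) x := by
        simp only [B, hm', hm'']
        rw [pow_succ, Nat.mod_mul_right_div_self]
      have h4 : V x / 2 ^ m / 2 = V x / 2 ^ (m + 1) := by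
        rw [Nat.div_div_eq_div_mul, pow_succ]
      simp only [st, hm', pushBits, h3, h4])
  refine ⟨fun x => st t x 0, fun x => st t x 1, fun x => st t x 2, ?_⟩
  have e0 : st 0 = fun x => ![(V x : ℝ), 2 ^ (k + t) / 2, 0, D x] := by
    funext x
    have hR : R 0 x = V x := Nat.mod_eq_of_lt (hV x)
    have hB0 : B 0 x = 0 := by
      simp only [B, Nat.sub_zero]
      rw [Nat.mod_eq_of_lt ((hV x).trans (Nat.pow_lt_pow_right one_lt_two (by omega))),
        Nat.div_eq_of_lt (hV x)]
    simp only [st, hR, hB0, Nat.sub_zero, pushBits]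
    simp
  have et : st t = fun x => ![st t x 0, st t x 1, st t x 2, pushBits t (V x / 2 ^ k) (D x)] := by
    funext x
    simp [st]
  rw [← e0, ← et]
  exact main

end Encoding

/-! ### Simulating a network neuron by neuron -/

section Simulation

variable {X : Type} {M : ℝ}

/-- The fixed-point output of a neuron with integer weights `a` and integer bias `c`. Inputs and
outputs have `T` bits; the weights and the bias are understood with the factors `2 ^ (-T)` and
`2 ^ (-2 * T)`. -/
def fixedPointNeuron (T k : ℕ) (a : ℕ → ℤ) (c : ℤ) (g : ℕ → ℕ) : ℕ :=
  (∑ j ∈ Finset.range k, a j * (g j : ℤ) + c).toNat / 2 ^ T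

/-- Computing one neuron from the stack of its inputs, and pushing the result. -/
theorem computes_neuron (hM : 4 ≤ M) (T k : ℕ) (G : X → ℕ → ℕ) (D : X → ℝ) (a : ℕ → ℤ) (c : ℤ)
    (hG : ∀ x, ∀ i < k, G x i < 2 ^ T) (ha : ∀ i < k, |(a i : ℝ)| ≤ 2 ^ T * M)
    (hc : |(c : ℝ)| ≤ 2 ^ (T + T) * M) (hD : ∀ x, 0 ≤ D x ∧ D x < 1)
    (hV : ∀ x, (∑ j ∈ Finset.range k, a j * (G x j : ℤ) + c).toNat < 2 ^ (T + T)) :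
    Computes M 10 (fun x => ![stack T (G x) k, D x]) (k * (2 * T + 2) + 5 * T + 4)
      (fun x => ![stack T (G x) k, pushBits T (fixedPointNeuron T k a c (G x)) (D x)]) := by
  set V : X → ℕ := fun x => (∑ j ∈ Finset.range k, a j * (G x j : ℤ) + c).toNat with hVdef
  set w : ℕ → ℝ := fun i => a i / 2 ^ T with hw
  set p : X → ℝ := fun x => 0 + ∑ i ∈ Finset.range k, max 0 (w i) * (G x i / 2 ^ T) with hp
  set n : X → ℝ := fun x => 0 + ∑ i ∈ Finset.range k, max 0 (-w i) * (G x i / 2 ^ T) with hn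
  have s := fun x => stack_mem T (G x) k
  have hV' : ∀ x, (V x : ℝ) / 2 ^ (T + T) = max 0 (p x - n x + c / 2 ^ (T + T)) := fun x => by
    have h1 : (V x : ℝ) = max 0 (∑ j ∈ Finset.range k, (a j : ℝ) * G x j + c) := by
      have h2 : ((V x : ℕ) : ℤ) = max (∑ j ∈ Finset.range k, a j * (G x j : ℤ) + c) 0 :=
        Int.toNat_eq_max _
      rw [max_comm] at h2
      exact_mod_cast congrArg (Int.cast : ℤ → ℝ) h2
    have h3 : p x - n x + c / 2 ^ (T + T) =
        (∑ j ∈ Finset.range k, (a j : ℝ) * G x j + c) / 2 ^ (T + T) := by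
      simp only [hp, hn, zero_add]
      rw [← Finset.sum_sub_distrib, add_div, Finset.sum_div]
      congr 1
      refine Finset.sum_congr rfl fun j _ => ?_
      have h4 : max 0 (w j) - max 0 (-w j) = w j := by
        rcases le_total 0 (w j) with h | h
        · rw [max_eq_right h, max_eq_left (by linarith), sub_zero]
        · rw [max_eq_left h, max_eq_right (by linarith)]; ring
      rw [← sub_mul, h4, hw, pow_add]
      field_simp
    rw [h3, h1, ← max_div_div_right (by positivity), zero_div]
  have h1 : Computes M 10 (fun x => ![stack T (G x) k, D x]) 1
      (fun x => Sum.elim ![stack T (G x) k, 0, 0] ![stack T (G x) k, D x]) := by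
    refine LayerTo.computes ?_ (by simp)
    rintro (i | i) <;> fin_cases i
    · exact isNeuron_coord (by linarith) (0 : Fin 2) (fun x => (s x).1)
    · exact ⟨0, 0, by simp; linarith, by simp; linarith, by simp⟩
    · exact ⟨0, 0, by simp; linarith, by simp; linarith, by simp⟩
    · exact isNeuron_coord (by linarith) (0 : Fin 2) (fun x => (s x).1)
    · exact isNeuron_coord (by linarith) (1 : Fin 2) (fun x => (hD x).1)
  have h2 := (computes_dot hM T k G (fun _ => 0) (fun _ => 0) w hG (fun i hi => by
      rw [hw, abs_div, abs_of_pos (by positivity : (0 : ℝ) < 2 ^ T), div_le_iff₀ (by positivity),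
        mul_comm]
      exact ha i hi) (fun _ => le_rfl) (fun _ => le_rfl)).frame (w' := 10) (by linarith)
    (fun x => ![stack T (G x) k, D x]) (fun x i => by fin_cases i; exacts [(s x).1, (hD x).1])
    (by simp)
  have h3 : Computes M 10 (fun x => Sum.elim ![0, p x, n x] ![stack T (G x) k, D x]) 1
      (fun x => Sum.elim ![(V x : ℝ) / 2 ^ (T + T), 1 / 2] ![stack T (G x) k, D x]) := by
    refine LayerTo.computes ?_ (by simp)
    rintro (i | i) <;> fin_cases i
    · refine ⟨Sum.elim ![0, 1, -1] ![0, 0], c / 2 ^ (T + T), ?_, ?_, fun x => ?_⟩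
      · rintro (j | j) <;> fin_cases j <;> simp <;> linarith
      · rw [abs_div, abs_of_pos (by positivity : (0 : ℝ) < 2 ^ (T + T)),
          div_le_iff₀ (by positivity), mul_comm]
        exact hc
      · simp only [Fin.zero_eta, Sum.elim_inl, Matrix.cons_val_zero, hV' x]
        simp [Fin.sum_univ_three, sub_eq_add_neg]
    · refine ⟨0, 1 / 2, by simp; linarith, by norm_num [abs_le]; linarith, fun x => by simp⟩
    · exact isNeuron_coord (by linarith) (Sum.inr 0 : Fin 3 ⊕ Fin 2) (fun x => (s x).1)
    · exact isNeuron_coord (by linarith) (Sum.inr 1 : Fin 3 ⊕ Fin 2) (fun x => (hD x).1)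
  have h4 := (Computes.double (M := M) (w := 2)
    (φ := fun x => ![(V x : ℝ) / 2 ^ (T + T), 1 / 2]) (by linarith)
    (by simp) (fun x i => by fin_cases i <;> simp; positivity) (T + T)).frame (w' := 10)
    (by linarith)
    (fun x => ![stack T (G x) k, D x]) (fun x i => by fin_cases i; exacts [(s x).1, (hD x).1])
    (by simp)
  have h5 : Computes M 10 (fun x => Sum.elim
        (fun i : Fin 2 => 2 ^ (T + T) * (![(V x : ℝ) / 2 ^ (T + T), 1 / 2] : Fin 2 → ℝ) i)
        ![stack T (G x) k, D x]) 1
      (fun x => Sum.elim ![(V x : ℝ), 2 ^ (T + T) / 2, 0, D x] ![stack T (G x) k]) := by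
    refine LayerTo.computes ?_ (by simp)
    rintro (i | i) <;> fin_cases i
    · refine isNeuron_of_nonneg (fun x => Nat.cast_nonneg _) (Sum.elim ![1, 0] ![0, 0]) 0 ?_
        (by simp; linarith) (fun x => ?_)
      · rintro (j | j) <;> fin_cases j <;> simp <;> linarith
      · simp
        field_simp
    · refine isNeuron_of_nonneg (fun x => by simp; positivity) (Sum.elim ![0, 1] ![0, 0]) 0 ?_
        (by simp; linarith) (fun x => ?_)
      · rintro (j | j) <;> fin_cases j <;> simp <;> linarith
      · simp
        field_simp
    · exact ⟨0, 0, by simp; linarith, by simp; linarith, by simp⟩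
    · exact isNeuron_coord (by linarith) (Sum.inr 1 : Fin 2 ⊕ Fin 2) (fun x => (hD x).1)
    · exact isNeuron_coord (by linarith) (Sum.inr 0 : Fin 2 ⊕ Fin 2) (fun x => (s x).1)
  obtain ⟨f, g, h, h6⟩ := computes_extract hM T T V D hV hD
  have h6 := h6.frame (w' := 10) (by linarith) (fun x => ![stack T (G x) k])
    (fun x i => by fin_cases i; exact (s x).1) (by simp)
  have h7 : Computes M 10 (fun x => Sum.elim ![f x, g x, h x, pushBits T (V x / 2 ^ T) (D x)]
        ![stack T (G x) k]) 1
      (fun x => ![stack T (G x) k, pushBits T (fixedPointNeuron T k a c (G x)) (D x)]) := by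
    refine LayerTo.computes (fun i => ?_) (by simp)
    fin_cases i
    · exact isNeuron_coord (by linarith) (Sum.inr 0 : Fin 4 ⊕ Fin 1) (fun x => (s x).1)
    · exact isNeuron_coord (by linarith) (Sum.inl 3 : Fin 4 ⊕ Fin 1)
        (fun x => (pushBits_mem _ _ (hD x)).1)
  rw [show k * (2 * T + 2) + 5 * T + 4 = 1 + k * (2 * T + 2) + 1 + (T + T) + 1 + T * 3 + 1 by ring]
  exact (((((h1.trans h2).trans h3).trans h4).trans h5).trans h6).trans h7

/-- Replacing the stack of the inputs of a layer by the stack of its outputs. -/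
theorem computes_layer (hM : 4 ≤ M) (T k m : ℕ) (G : X → ℕ → ℕ) (a : ℕ → ℕ → ℤ) (c : ℕ → ℤ)
    (hG : ∀ x, ∀ i < k, G x i < 2 ^ T) (ha : ∀ i < m, ∀ j < k, |(a i j : ℝ)| ≤ 2 ^ T * M)
    (hc : ∀ i < m, |(c i : ℝ)| ≤ 2 ^ (T + T) * M)
    (hV : ∀ x, ∀ i < m, (∑ j ∈ Finset.range k, a i j * (G x j : ℤ) + c i).toNat < 2 ^ (T + T)) :
    Computes M 10 (fun x => ![stack T (G x) k]) (m * (k * (2 * T + 2) + 5 * T + 4) + 2)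
      (fun x => ![stack T (fun i => fixedPointNeuron T k (a i) (c i) (G x)) m]) := by
  have s := fun x => stack_mem T (G x) k
  have h1 : Computes M 10 (fun x => ![stack T (G x) k]) 1
      (fun x => ![stack T (G x) k,
        stack T (fun i => fixedPointNeuron T k (a i) (c i) (G x)) 0]) := by
    refine LayerTo.computes (fun i => ?_) (by simp)
    fin_cases i
    · exact isNeuron_coord (by linarith) (0 : Fin 1) (fun x => (s x).1)
    · exact ⟨0, 0, by simp; linarith, by simp; linarith, by simp [stack]⟩
  have h2 := Computes.iterate (M := M) (w := 10) (c := k * (2 * T + 2) + 5 * T + 4)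
    (fun j x => ![stack T (G x) k, stack T (fun i => fixedPointNeuron T k (a i) (c i) (G x)) j]) m
    (fun j hj => computes_neuron hM T k G _ (a j) (c j) hG (ha j hj) (hc j hj)
      (fun x => stack_mem _ _ _) (fun x => hV x j hj))
  have h3 : Computes M 10 (fun x => ![stack T (G x) k,
      stack T (fun i => fixedPointNeuron T k (a i) (c i) (G x)) m]) 1
      (fun x => ![stack T (fun i => fixedPointNeuron T k (a i) (c i) (G x)) m]) :=
    Computes.copy (by linarith) (by simp) (fun _ => 1) (fun x i => by fin_cases i; rfl)
      (fun x i => by fin_cases i; exact (stack_mem _ _ _).1)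
  rw [show m * (k * (2 * T + 2) + 5 * T + 4) + 2 = 1 + m * (k * (2 * T + 2) + 5 * T + 4) + 1 by
    ring]
  exact (h1.trans h2).trans h3

end Simulation

/-! ### Error propagation -/

theorem ReLUNetwork.one_le_depth {k : ℕ} (N : ReLUNetwork k) : 1 ≤ N.depth := by
  cases N with
  | output W b => exact le_rfl
  | hidden W b rest => exact Nat.le_add_left 1 _

theorem ReLUNetwork.le_width {k : ℕ} (N : ReLUNetwork k) : k ≤ N.width := by
  cases N with
  | output W b => exact le_rfl
  | hidden W b rest => exact le_max_left _ _

/-- The effect on an affine form of perturbing both the coefficients and the arguments. -/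
theorem abs_affine_sub_le {k : ℕ} {n Q η Z e ζ : ℝ} (hk : (k : ℝ) ≤ n) (w w' z g : Fin k → ℝ)
    (b b' : ℝ) (hw : ∀ j, |w j| ≤ Q) (hw' : ∀ j, |w' j - w j| ≤ η) (hg : ∀ j, |g j| ≤ Z)
    (hz : ∀ j, |z j - g j| ≤ e) (hb : |b' - b| ≤ ζ) (hQ : 0 ≤ Q) (hη : 0 ≤ η) (hZ : 0 ≤ Z)
    (he : 0 ≤ e) :
    |(∑ j, w' j * g j + b') - (∑ j, w j * z j + b)| ≤ n * (η * Z + Q * e) + ζ := by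
  have h1 : (∑ j, w' j * g j + b') - (∑ j, w j * z j + b) =
      ∑ j, ((w' j - w j) * g j - w j * (z j - g j)) + (b' - b) := by
    rw [add_sub_add_comm, ← Finset.sum_sub_distrib]
    congr 1
    exact Finset.sum_congr rfl fun j _ => by ring
  have h2 : |∑ j, ((w' j - w j) * g j - w j * (z j - g j))| ≤ ∑ _j : Fin k, (η * Z + Q * e) := by
    refine (Finset.abs_sum_le_sum_abs _ _).trans (Finset.sum_le_sum fun j _ => ?_)
    refine (abs_sub _ _).trans ?_
    rw [abs_mul, abs_mul]
    gcongr
    exacts [hw' j, hg j, hw j, hz j]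
  rw [h1]
  refine (abs_add_le _ _).trans (add_le_add (h2.trans ?_) hb)
  rw [Finset.sum_const, Finset.card_univ, Fintype.card_fin, nsmul_eq_mul]
  gcongr

theorem abs_floor_div_sub_le {S : ℝ} (hS : 0 < S) (y : ℝ) : |(⌊y * S⌋ : ℝ) / S - y| ≤ 1 / S := by
  rw [div_sub' hS.ne', abs_div, abs_of_pos hS]
  gcongr
  rw [abs_le]
  constructor <;> linarith [Int.floor_le (y * S), Int.lt_floor_add_one (y * S), mul_comm y S]

theorem abs_floor_le {y K : ℝ} (h : |y| ≤ K) : |(⌊y⌋ : ℝ)| ≤ K + 1 := by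
  rw [abs_le] at h ⊢
  constructor <;> linarith [Int.floor_le y, Int.lt_floor_add_one y]

/-- One layer of fixed-point neurons: values stay in range, and the errors grow by a factor of
at most `R`. Values are stored in units of `2 ^ E / 2 ^ T`. -/
theorem fixedPointNeuron_spec {k n T E : ℕ} {Q R Z e : ℝ} (hn : 1 ≤ n) (hk : k ≤ n)
    (hQ : 1 ≤ Q) (hR : 4 * n * Q ≤ R) (w z : Fin k → ℝ) (b : ℝ) (a : ℕ → ℤ)
    (hw : ∀ j, |w j| ≤ Q) (hb : |b| ≤ Q) (ha : ∀ j : Fin k, a j = ⌊w j * 2 ^ T⌋)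
    (g : ℕ → ℕ) (hg : ∀ j : Fin k, g j * (2 ^ E / 2 ^ T) ≤ Z) (hZ1 : 1 ≤ Z)
    (hZ : R * Z < 2 ^ E) (hz : ∀ j : Fin k, |z j - g j * (2 ^ E / 2 ^ T)| ≤ e)
    (he : 2 ^ E / 2 ^ T ≤ e) :
    let c : ℤ := ⌊b * (2 ^ (T + T) / 2 ^ E)⌋
    (∑ j ∈ Finset.range k, a j * (g j : ℤ) + c).toNat < 2 ^ (T + T) ∧
    fixedPointNeuron T k a c g * (2 ^ E / 2 ^ T) ≤ R * Z ∧
    |max 0 (∑ j, w j * z j + b) - fixedPointNeuron T k a c g * (2 ^ E / 2 ^ T)| ≤ R * e := by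
  intro c
  set u : ℝ := 2 ^ E / 2 ^ T with hu
  have hu0 : 0 < u := by positivity
  set V : ℕ := (∑ j ∈ Finset.range k, a j * (g j : ℤ) + c).toNat with hV
  have hn' : (1 : ℝ) ≤ n := by exact_mod_cast hn
  have hk' : (k : ℝ) ≤ n := by exact_mod_cast hk
  have hQn : (n : ℝ) ≤ n * Q := le_mul_of_one_le_right (by linarith) hQ
  have hQn' : Q ≤ n * Q := le_mul_of_one_le_left (by linarith) hn'
  have hT : (0 : ℝ) < 2 ^ T := by positivity
  have hS : (2 : ℝ) ^ (T + T) / 2 ^ E = 2 ^ T / u := by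
    rw [hu, pow_add]; field_simp
  have hu1 : u / 2 ^ T ≤ u := div_le_self hu0.le (one_le_pow₀ one_le_two)
  -- The integer sum, in the units in which the values are measured.
  have hVr : (V : ℝ) * (u / 2 ^ T) =
      max 0 (∑ j : Fin k, ((a j : ℝ) / 2 ^ T) * (g j * u) + c / (2 ^ (T + T) / 2 ^ E)) := by
    have h1 : (V : ℝ) = max 0 (∑ j ∈ Finset.range k, (a j : ℝ) * g j + c) := by
      have h2 : ((V : ℕ) : ℤ) = max (∑ j ∈ Finset.range k, a j * (g j : ℤ) + c) 0 :=
        Int.toNat_eq_max _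
      rw [max_comm] at h2
      exact_mod_cast congrArg (Int.cast : ℤ → ℝ) h2
    rw [h1, max_mul_of_nonneg _ _ (by positivity), zero_mul, add_mul, Finset.sum_mul,
      Finset.sum_range]
    congr 2
    · exact Finset.sum_congr rfl fun j _ => by ring
    · rw [hS]; field_simp
  have hwa : ∀ j : Fin k, |(a j : ℝ) / 2 ^ T - w j| ≤ 1 / 2 ^ T := fun j => by
    rw [ha j]; exact abs_floor_div_sub_le hT _
  have hbc : |(c : ℝ) / (2 ^ (T + T) / 2 ^ E) - b| ≤ u / 2 ^ T := by
    refine (abs_floor_div_sub_le (by positivity) b).trans_eq ?_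
    rw [hS, one_div_div]
  have hg0 : ∀ j : Fin k, |(g j : ℝ) * u| ≤ Z := fun j => by
    rw [abs_of_nonneg (by positivity)]; exact hg j
  have hbound : (V : ℝ) * (u / 2 ^ T) ≤ R * Z := by
    rw [hVr]
    refine max_le (by nlinarith) ?_
    have h1 : c / (2 ^ (T + T) / 2 ^ E : ℝ) ≤ Q := by
      rw [div_le_iff₀ (by positivity)]
      refine (Int.floor_le _).trans ?_
      have := (abs_le.1 hb).2
      gcongr
    have h2 : ∀ j : Fin k, ((a j : ℝ) / 2 ^ T) * (g j * u) ≤ Q * Z := fun j => by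
      have h3 : (a j : ℝ) / 2 ^ T ≤ Q := by
        rw [div_le_iff₀ hT, ha j]
        refine (Int.floor_le _).trans ?_
        have := (abs_le.1 (hw j)).2
        gcongr
      have h4 : 0 ≤ (g j : ℝ) * u := by positivity
      calc _ ≤ Q * (g j * u) := by gcongr
        _ ≤ Q * Z := by have := hg j; gcongr
    calc _ ≤ ∑ _j : Fin k, Q * Z + Q := add_le_add (Finset.sum_le_sum fun j _ => h2 j) h1
      _ = k * (Q * Z) + Q := by simp
      _ ≤ n * (Q * Z) + n * (Q * Z) := by
        have : 0 ≤ Q * Z := by positivity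
        gcongr
        nlinarith
      _ ≤ (4 * n * Q) * Z := by
        have : 0 ≤ n * (Q * Z) := by positivity
        nlinarith
      _ ≤ R * Z := by gcongr
  have hZE : Z ≤ 2 ^ E := by
    have : 1 ≤ R := by nlinarith
    nlinarith
  have hdiv : ((V / 2 ^ T : ℕ) : ℝ) * u ≤ V * (u / 2 ^ T) := by
    have := Nat.cast_div_le (α := ℝ) (m := V) (n := 2 ^ T)
    push_cast at this
    calc _ ≤ (V : ℝ) / 2 ^ T * u := by gcongr
      _ = _ := by ring
  have hdiv' : V * (u / 2 ^ T) - u ≤ ((V / 2 ^ T : ℕ) : ℝ) * u := by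
    have h1 : V ≤ 2 ^ T * (V / 2 ^ T) + 2 ^ T := by
      have := Nat.div_add_mod V (2 ^ T)
      have := Nat.mod_lt V (show 0 < 2 ^ T by positivity)
      omega
    have h2 : (V : ℝ) ≤ 2 ^ T * ((V / 2 ^ T : ℕ) : ℝ) + 2 ^ T := by exact_mod_cast h1
    calc V * (u / 2 ^ T) - u
        ≤ (2 ^ T * ((V / 2 ^ T : ℕ) : ℝ) + 2 ^ T) * (u / 2 ^ T) - u := by gcongr
      _ = _ := by field_simp; ring
  refine ⟨?_, hdiv.trans hbound, ?_⟩
  · have h1 : (V : ℝ) * (u / 2 ^ T) < 2 ^ E := hbound.trans_lt hZ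
    have h2 : (V : ℝ) < 2 ^ (T + T) := by
      rw [← lt_div_iff₀ (by positivity)] at h1
      refine h1.trans_eq ?_
      rw [hu, pow_add]; field_simp
    exact_mod_cast h2
  · have h1 := abs_affine_sub_le hk' w (fun j => (a j : ℝ) / 2 ^ T) z (fun j => g j * u) b
      (c / (2 ^ (T + T) / 2 ^ E)) hw hwa hg0 hz hbc (by linarith) (by positivity) (by linarith)
      (hu0.le.trans he)
    have h2 : |max 0 (∑ j, w j * z j + b) - V * (u / 2 ^ T)| ≤
        n * (1 / 2 ^ T * Z + Q * e) + u / 2 ^ T := by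
      rw [hVr, max_comm 0, max_comm 0, abs_sub_comm]
      exact (abs_max_sub_max_le_abs _ _ _).trans h1
    have h3 : 1 / 2 ^ T * Z ≤ u := by
      rw [hu, one_div_mul_eq_div]; gcongr
    have h4 : n * (1 / 2 ^ T * Z + Q * e) + u / 2 ^ T + u ≤ R * e := by
      calc _ ≤ n * (e + Q * e) + e + e := by gcongr <;> linarith
        _ ≤ (4 * n * Q) * e := by
          have : 0 ≤ e := hu0.le.trans he
          nlinarith
        _ ≤ R * e := by
          have : 0 ≤ e := hu0.le.trans he
          gcongr
    rw [abs_le] at h2 ⊢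
    change _ ≤ _ - ((V / 2 ^ T : ℕ) : ℝ) * u ∧ _ - ((V / 2 ^ T : ℕ) : ℝ) * u ≤ _
    constructor <;> linarith [h2.1, h2.2]

/-- Simulation of a network: from the stack of the approximate inputs, a program with at most ten
registers computes the output of the network, up to an error that has grown by a factor `2 ^ r`
in each layer. -/
theorem ReLUNetwork.exists_simulation {X : Type} {k n T E r : ℕ} {Q M : ℝ} (N : ReLUNetwork k)
    (hn : 1 ≤ n) (hN : N.width ≤ n) (hQ : 1 ≤ Q) (hNQ : N.WeightsBoundedBy Q) (hM : 4 ≤ M)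
    (hQM : Q + 1 ≤ M) (hr : 4 * n * Q ≤ 2 ^ r) (hT : 1 ≤ T) (G : X → ℕ → ℕ)
    (z : X → Fin k → ℝ) (e Z : ℝ)
    (hG : ∀ x, ∀ i : Fin k, G x i * (2 ^ E / 2 ^ T) ≤ Z) (hZ1 : 1 ≤ Z)
    (hZ : Z * 2 ^ (r * N.depth) ≤ 2 ^ E)
    (hz : ∀ x, ∀ i : Fin k, |z x i - G x i * (2 ^ E / 2 ^ T)| ≤ e) (he : 2 ^ E / 2 ^ T ≤ e) :
    ∃ (a : X → Fin 2 → ℝ) (b : ℝ) (D : ℕ),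
      Computes M 10 (fun x => ![stack T (G x) k]) D a ∧ (∀ x i, 0 ≤ a x i) ∧ |b| ≤ Q ∧
      D ≤ N.depth * (16 * n ^ 2 * T) ∧
      ∀ x, |2 ^ E * (a x 0 - a x 1) + b - N.eval (z x)| ≤ e * 2 ^ (r * N.depth) := by
  have hn' : (1 : ℝ) ≤ n := by exact_mod_cast hn
  have hr1 : (1 : ℝ) < 2 ^ r := by nlinarith
  have hT0 : (0 : ℝ) < 2 ^ T := by positivity
  have hlt : ∀ {Z' : ℝ} {d : ℕ}, 1 ≤ Z' → 1 ≤ d → Z' * 2 ^ (r * d) ≤ 2 ^ E → Z' < 2 ^ E := by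
    intro Z' d h1 hd h2
    have h3 : (2 : ℝ) ^ r ≤ 2 ^ (r * d) :=
      pow_le_pow_right₀ one_le_two (Nat.le_mul_of_pos_right _ hd)
    nlinarith
  have hGlt : ∀ x, ∀ i < k, G x i < 2 ^ T := fun x i hi => by
    have h1 := (hG x ⟨i, hi⟩).trans_lt (hlt hZ1 N.one_le_depth hZ)
    rw [← mul_div_assoc, div_lt_iff₀ hT0, mul_comm, mul_lt_mul_iff_right₀ (by positivity)] at h1
    exact_mod_cast h1
  induction N generalizing e Z G with
  | @output k W b =>
    have hk : k ≤ n := hN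
    let w : ℕ → ℝ := fun j => if h : j < k then W 0 ⟨j, h⟩ else 0
    have hw : ∀ j : Fin k, w j = W 0 j := fun j => by simp [w]
    have h1 : Computes M 10 (fun x => ![stack T (G x) k]) 1
        (fun x => ![stack T (G x) k, 0, 0]) := by
      refine LayerTo.computes (fun i => ?_) (by simp)
      fin_cases i
      · exact isNeuron_coord (by linarith) (0 : Fin 1) (fun x => (stack_mem _ _ _).1)
      · exact ⟨0, 0, by simp; linarith, by simp; linarith, by simp⟩
      · exact ⟨0, 0, by simp; linarith, by simp; linarith, by simp⟩
    have h2 := (computes_dot hM T k G (fun _ => 0) (fun _ => 0) w hGlt (fun i hi => by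
      have := hNQ.1 0 ⟨i, hi⟩
      rw [← hw] at this
      simp only at this
      linarith) (fun _ => le_rfl) (fun _ => le_rfl)).mono_width (w' := 10) (by norm_num)
    have hnn : ∀ v : ℕ → ℝ, ∀ x,
        0 ≤ 0 + ∑ i ∈ Finset.range k, max 0 (v i) * ((G x i : ℝ) / 2 ^ T) := fun v x => by
      rw [zero_add]
      exact Finset.sum_nonneg fun i _ => mul_nonneg (le_max_left _ _) (by positivity)
    have h3 : Computes M 10 (fun x => ![0,
          0 + ∑ i ∈ Finset.range k, max 0 (w i) * ((G x i : ℝ) / 2 ^ T),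
          0 + ∑ i ∈ Finset.range k, max 0 (-w i) * ((G x i : ℝ) / 2 ^ T)]) 1
        (fun x => ![0 + ∑ i ∈ Finset.range k, max 0 (w i) * ((G x i : ℝ) / 2 ^ T),
          0 + ∑ i ∈ Finset.range k, max 0 (-w i) * ((G x i : ℝ) / 2 ^ T)]) :=
      Computes.copy (by linarith) (by simp) ![1, 2] (fun x i => by fin_cases i <;> rfl)
        (fun x i => by fin_cases i; exacts [hnn w x, hnn (fun i => -w i) x])
    refine ⟨_, b 0, _, (h1.trans h2).trans h3,
      fun x i => by fin_cases i; exacts [hnn w x, hnn (fun i => -w i) x], hNQ.2 0, ?_, ?_⟩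
    · change _ ≤ 1 * _
      have : k * (2 * T + 2) ≤ n * (2 * T + 2) := Nat.mul_le_mul_right _ hk
      nlinarith [Nat.mul_le_mul hn hT, Nat.mul_le_mul hn hn]
    · intro x
      have h4 : 2 ^ E * ((0 + ∑ i ∈ Finset.range k, max 0 (w i) * ((G x i : ℝ) / 2 ^ T)) -
          (0 + ∑ i ∈ Finset.range k, max 0 (-w i) * ((G x i : ℝ) / 2 ^ T))) =
          ∑ j : Fin k, W 0 j * (G x j * (2 ^ E / 2 ^ T)) := by
        rw [zero_add, zero_add, ← Finset.sum_sub_distrib, Finset.mul_sum, Finset.sum_range]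
        refine Finset.sum_congr rfl fun j _ => ?_
        have h5 : max 0 (w j) - max 0 (-w j) = w j := by
          rcases le_total 0 (w j) with h | h
          · rw [max_eq_right h, max_eq_left (by linarith), sub_zero]
          · rw [max_eq_left h, max_eq_right (by linarith)]; ring
        rw [← sub_mul, h5, hw]
        ring
      have h6 := abs_affine_sub_le (n := n) (Q := Q) (η := 0) (Z := Z) (e := e) (ζ := 0)
        (by exact_mod_cast hk) (W 0) (W 0) (z x)
        (fun j => G x j * (2 ^ E / 2 ^ T)) (b 0) (b 0) (hNQ.1 0) (by simp)
        (fun j => by rw [abs_of_nonneg (by positivity)]; exact hG x j) (hz x) (by simp)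
        (by linarith) le_rfl (by linarith) ((by positivity : (0 : ℝ) ≤ _).trans he)
      rw [← h4] at h6
      refine h6.trans ?_
      change _ ≤ e * 2 ^ (r * 1)
      have he0 : 0 ≤ e := (by positivity : (0 : ℝ) ≤ _).trans he
      rw [mul_one]
      nlinarith [mul_nonneg (by positivity : (0 : ℝ) ≤ n * Q) he0]
  | @hidden k m W b rest ih =>
    have hk : k ≤ n := (le_max_left _ _).trans hN
    have hrn : rest.width ≤ n := (le_max_right _ _).trans hN
    have hm : m ≤ n := rest.le_width.trans hrn
    change Z * 2 ^ (r * (rest.depth + 1)) ≤ 2 ^ E at hZ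
    have hZ' : 2 ^ r * Z * 2 ^ (r * rest.depth) ≤ 2 ^ E := by
      refine le_trans (le_of_eq ?_) hZ
      rw [mul_add, pow_add]; ring
    have hZr : 1 ≤ 2 ^ r * Z := by nlinarith
    let a : ℕ → ℕ → ℤ := fun i j => if h : i < m ∧ j < k then ⌊W ⟨i, h.1⟩ ⟨j, h.2⟩ * 2 ^ T⌋ else 0
    let b' : ℕ → ℝ := fun i => if h : i < m then b ⟨i, h⟩ else 0
    let c : ℕ → ℤ := fun i => ⌊b' i * (2 ^ (T + T) / 2 ^ E)⌋
    let G' : X → ℕ → ℕ := fun x i => fixedPointNeuron T k (a i) (c i) (G x)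
    have hb' : ∀ i : Fin m, b' i = b i := fun i => by simp [b']
    have hspec := fun x (i : Fin m) => fixedPointNeuron_spec hn hk hQ hr (W i) (z x) (b' i)
      (a i) (hNQ.1 i) (by rw [hb']; exact hNQ.2.1 i) (fun j => by simp [a]) (G x) (hG x) hZ1
      (hlt hZr rest.one_le_depth hZ') (hz x) he
    have h1 := computes_layer hM T k m G a c hGlt
      (fun i hi j hj => by
        have h2 : |W ⟨i, hi⟩ ⟨j, hj⟩ * 2 ^ T| ≤ Q * 2 ^ T := by
          rw [abs_mul, abs_of_pos hT0]
          gcongr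
          exact hNQ.1 _ _
        have h3 := abs_floor_le h2
        have h4 : a i j = ⌊W ⟨i, hi⟩ ⟨j, hj⟩ * 2 ^ T⌋ := by simp [a, hi, hj]
        rw [h4]
        have : (1 : ℝ) ≤ 2 ^ T := one_le_pow₀ one_le_two
        nlinarith)
      (fun i hi => by
        have h2 : |b' i * (2 ^ (T + T) / 2 ^ E)| ≤ Q * 2 ^ (T + T) := by
          rw [abs_mul, abs_of_pos (by positivity : (0 : ℝ) < 2 ^ (T + T) / 2 ^ E)]
          gcongr
          · have := hNQ.2.1 ⟨i, hi⟩
            rw [← hb'] at this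
            exact this
          · exact div_le_self (by positivity) (one_le_pow₀ one_le_two)
        have h3 := abs_floor_le h2
        have : (1 : ℝ) ≤ 2 ^ (T + T) := one_le_pow₀ one_le_two
        simp only [c]
        nlinarith)
      (fun x i hi => (hspec x ⟨i, hi⟩).1)
    obtain ⟨a', b₁, D, hD, ha', hb₁, hDle, herr⟩ := ih hrn hNQ.2.2 G'
      (fun x i => max 0 ((W *ᵥ z x + b) i)) (2 ^ r * e) (2 ^ r * Z)
      (fun x i => (hspec x i).2.1) hZr hZ' (fun x i => by
        have h2 : (W *ᵥ z x + b) i = ∑ j, W i j * z x j + b' i := by rw [hb']; rfl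
        rw [h2]
        exact (hspec x i).2.2) (he.trans (by
        have he0 : 0 ≤ e := (by positivity : (0 : ℝ) ≤ _).trans he
        nlinarith)) (fun x i hi => by
        have h2 := ((hspec x ⟨i, hi⟩).2.1).trans_lt (hlt hZr rest.one_le_depth hZ')
        rw [← mul_div_assoc, div_lt_iff₀ hT0, mul_comm, mul_lt_mul_iff_right₀ (by positivity)] at h2
        have h3 : (G' x i : ℝ) < 2 ^ T := h2
        exact_mod_cast h3)
    refine ⟨a', b₁, _, h1.trans hD, ha', hb₁, ?_, fun x => (herr x).trans_eq ?_⟩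
    · change _ ≤ (rest.depth + 1) * _
      have h2 : m * (k * (2 * T + 2) + 5 * T + 4) + 2 ≤ 16 * n ^ 2 * T := by
        have h3 : n ≤ n * n := Nat.le_mul_self n
        have h4 : n * n ≤ n * n * T := Nat.le_mul_of_pos_right _ hT
        have h5 : n * T ≤ n * n * T := Nat.mul_le_mul_right _ h3
        calc m * (k * (2 * T + 2) + 5 * T + 4) + 2
            ≤ n * (n * (2 * T + 2) + 5 * T + 4) + 2 := by gcongr
          _ = 2 * (n * n * T) + 2 * (n * n) + 5 * (n * T) + 4 * n + 2 := by ring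
          _ ≤ 16 * (n * n * T) := by omega
          _ = 16 * n ^ 2 * T := by ring
      linarith
    · change _ = e * 2 ^ (r * (rest.depth + 1))
      rw [mul_add, pow_add]; ring

/-! ### Reading the input -/

section Input

variable {X : Type} {M : ℝ}

/-- Moving the leading binary digit of `f` to the stack `q`. The digit is a discontinuous function
of `f`; the layer computes it correctly unless `f` is in a short interval to the left of `1 / 2`,
whose length is the inverse of the largest weight. -/
theorem computes_readBit (hM : 4 ≤ M) {s : ℝ} (hs : 0 < s) (hsM : s ≤ M) (f q : X → ℝ)
    (hf : ∀ x, 0 ≤ f x ∧ f x < 1) (hq : ∀ x, 0 ≤ q x) (b : X → ℝ)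
    (hb : ∀ x, (b x = 0 ∧ f x ≤ 1 / 2 - 1 / s) ∨ (b x = 1 ∧ 1 / 2 ≤ f x)) :
    Computes M 4 (fun x => ![f x, q x]) 2 (fun x => ![2 * f x - b x, (1 + 2 * b x + q x) / 4]) := by
  have hbit : ∀ x, max 0 (s * f x + (1 - s / 2)) - max 0 (s * f x + -(s / 2)) = b x := fun x => by
    rcases hb x with ⟨h, h'⟩ | ⟨h, h'⟩
    · have : s * f x ≤ s / 2 - 1 := by
        calc s * f x ≤ s * (1 / 2 - 1 / s) := by gcongr
          _ = _ := by field_simp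
      rw [max_eq_left (by linarith), max_eq_left (by linarith), h, sub_zero]
    · have : s / 2 ≤ s * f x := by nlinarith
      rw [max_eq_right (by linarith), max_eq_right (by linarith), h]; ring
  have hb0 : ∀ x, 0 ≤ b x := fun x => by rcases hb x with ⟨h, _⟩ | ⟨h, _⟩ <;> rw [h]; norm_num
  refine Computes.trans (D := 1) (D' := 1) (ψ := fun x => ![f x, max 0 (s * f x + (1 - s / 2)),
    max 0 (s * f x + -(s / 2)), q x]) (LayerTo.computes (fun i => ?_) (by simp))
    (LayerTo.computes (fun i => ?_) (by simp)) <;> fin_cases i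
  · exact isNeuron_coord (by linarith) (0 : Fin 2) (fun x => (hf x).1)
  · refine ⟨![s, 0], 1 - s / 2, ?_, by rw [abs_le]; constructor <;> linarith, fun x => ?_⟩
    · intro j; fin_cases j <;> simp [abs_of_pos hs] <;> linarith
    · simp
  · refine ⟨![s, 0], -(s / 2), ?_, by rw [abs_le]; constructor <;> linarith, fun x => ?_⟩
    · intro j; fin_cases j <;> simp [abs_of_pos hs] <;> linarith
    · simp
  · exact isNeuron_coord (by linarith) (1 : Fin 2) hq
  · refine isNeuron_of_nonneg (fun x => ?_) ![2, -1, 1, 0] 0 ?_ (by simp; linarith) (fun x => ?_)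
    · have := (hf x).1
      rcases hb x with ⟨h, h'⟩ | ⟨h, h'⟩ <;> simp [h] <;> linarith
    · intro j; fin_cases j <;> simp <;> linarith
    · simp [Fin.sum_univ_four]; linarith [hbit x]
  · refine isNeuron_of_nonneg (fun x => ?_) ![0, 1 / 2, -1 / 2, 1 / 4] (1 / 4) ?_
      (by norm_num [abs_le]; linarith) (fun x => ?_)
    · have := hb0 x; have := hq x
      simp
      positivity
    · intro j; fin_cases j <;> norm_num [abs_le] <;> linarith
    · simp [Fin.sum_univ_four]; linarith [hbit x]

/-- None of the first `T` binary digits of `y` is misread with weights of size `s`. -/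
def ReadableBits (s : ℝ) (T : ℕ) (y : ℝ) : Prop :=
  ∀ j < T, Int.fract (2 ^ j * y) ∉ Set.Ioo (1 / 2 - 1 / s) (1 / 2)

/-- Reading the first `t` binary digits of a real number in `[0, 1)`. -/
theorem computes_readBits (hM : 4 ≤ M) {s : ℝ} (hs : 0 < s) (hsM : s ≤ M) (t : ℕ) (y : X → ℝ)
    (c : ℝ) (hy : ∀ x, 0 ≤ y x ∧ y x < 1) (hc : 0 ≤ c ∧ c < 1)
    (hgood : ∀ x, ReadableBits s t (y x)) :
    Computes M 4 (fun x => ![y x, c]) (t * 2)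
      (fun x => ![Int.fract (2 ^ t * y x), pushBits t ⌊2 ^ t * y x⌋₊ c]) := by
  have main := Computes.iterate (M := M) (w := 4) (c := 2)
    (fun j x => ![Int.fract (2 ^ j * y x), pushBits j ⌊2 ^ j * y x⌋₊ c]) t (fun j hj => by
      let b : X → ℕ := fun x => if 1 / 2 ≤ Int.fract (2 ^ j * y x) then 1 else 0
      have hb : ∀ x, ((b x : ℝ) = 0 ∧ Int.fract (2 ^ j * y x) ≤ 1 / 2 - 1 / s) ∨
          ((b x : ℝ) = 1 ∧ 1 / 2 ≤ Int.fract (2 ^ j * y x)) := fun x => by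
        have h1 := hgood x j hj
        rw [Set.mem_Ioo, not_and, not_lt] at h1
        by_cases h : 1 / 2 ≤ Int.fract (2 ^ j * y x)
        · exact Or.inr ⟨by simp only [b, if_pos h]; norm_num, h⟩
        · refine Or.inl ⟨by simp only [b, if_neg h]; norm_num, ?_⟩
          by_contra h2
          exact h (h1 (not_le.1 h2))
      have h1 := computes_readBit hM hs hsM (fun x => Int.fract (2 ^ j * y x))
        (fun x => pushBits j ⌊2 ^ j * y x⌋₊ c)
        (fun x => ⟨Int.fract_nonneg _, Int.fract_lt_one _⟩) (fun x => (pushBits_mem _ _ hc).1)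
        (fun x => (b x : ℝ)) hb
      convert h1 using 1
      funext x
      -- Doubling a number whose integer part is `⌊2 ^ j * y⌋₊` and whose leading digit is `b`.
      have h2 : (2 : ℝ) ^ j * y x = ⌊2 ^ j * y x⌋₊ + Int.fract (2 ^ j * y x) := by
        rw [natCast_floor_eq_intCast_floor (by have := (hy x).1; positivity)]
        exact (Int.floor_add_fract _).symm
      have h3 : (2 : ℝ) ^ (j + 1) * y x = ((2 * ⌊2 ^ j * y x⌋₊ + b x : ℕ) : ℝ) +
          (2 * Int.fract (2 ^ j * y x) - b x) := by
        push_cast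
        rw [pow_succ]
        linarith
      have h4 : 0 ≤ 2 * Int.fract (2 ^ j * y x) - b x ∧
          2 * Int.fract (2 ^ j * y x) - b x < 1 := by
        have := Int.fract_nonneg ((2 : ℝ) ^ j * y x)
        have := Int.fract_lt_one ((2 : ℝ) ^ j * y x)
        have : 0 < 1 / s := by positivity
        rcases hb x with ⟨h, h'⟩ | ⟨h, h'⟩ <;> rw [h] <;> constructor <;> linarith
      have hb2 : b x < 2 := by
        simp only [b]; split_ifs <;> norm_num
      have h5 : ⌊(2 : ℝ) ^ (j + 1) * y x⌋₊ = 2 * ⌊2 ^ j * y x⌋₊ + b x := by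
        rw [Nat.floor_eq_iff (by have := (hy x).1; positivity), h3]
        constructor <;> linarith [h4.1, h4.2]
      have h6 : Int.fract ((2 : ℝ) ^ (j + 1) * y x) = 2 * Int.fract (2 ^ j * y x) - b x := by
        rw [h3, Int.fract_natCast_add, Int.fract_eq_self.2 h4]
      rw [h6, h5, pushBits, show (2 * ⌊2 ^ j * y x⌋₊ + b x) % 2 = b x by omega,
        show (2 * ⌊2 ^ j * y x⌋₊ + b x) / 2 = ⌊2 ^ j * y x⌋₊ by omega])
  have h0 : (fun x => ![Int.fract (2 ^ 0 * y x), pushBits 0 ⌊2 ^ 0 * y x⌋₊ c]) =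
      fun x => ![y x, c] := by
    funext x
    rw [pow_zero, one_mul, Int.fract_eq_self.2 (hy x), pushBits]
  rw [← h0]
  exact main

/-- The `t` most significant fixed-point digits of the number `v` in `[0, 2 ^ E)`. -/
noncomputable def fixedPoint (t E : ℕ) (v : ℝ) : ℕ := ⌊2 ^ t * (v / 2 ^ E)⌋₊

theorem fixedPoint_lt {t E : ℕ} {v : ℝ} (h : v < 2 ^ E) : fixedPoint t E v < 2 ^ t := by
  rw [fixedPoint, Nat.floor_lt' (by positivity)]
  push_cast
  have : v / 2 ^ E < 1 := (div_lt_one (by positivity)).2 h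
  have h2 : (0 : ℝ) < 2 ^ t := by positivity
  nlinarith

/-- Reading all coordinates in parallel, and collecting their digits on a single stack. Each value
is padded with `r` leading zeros. -/
theorem computes_input (hM : 4 ≤ M) {s : ℝ} (hs : 0 < s) (hsM : s ≤ M) {d w : ℕ} (hd : 5 * d ≤ w)
    (hw : 1 ≤ w) (t r E : ℕ) (v : X → Fin w → ℝ)
    (hv : ∀ x i, 0 ≤ v x i ∧ v x i < 2 ^ E)
    (hgood : ∀ x i, ReadableBits s t (v x i / 2 ^ E)) (G : X → ℕ → ℕ)
    (hG : ∀ x (i : Fin w), G x i = fixedPoint t E (v x i)) :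
    Computes M w v (t * 2 + 2) (fun x => ![stack (t + r) (G x) d]) := by
  have hdw : d ≤ w := by omega
  let ι : Fin d → Fin w := Fin.castLE hdw
  set c := pushBits r 0 0 with hc
  have hc01 : 0 ≤ c ∧ c < 1 := pushBits_mem _ _ ⟨le_rfl, one_pos⟩
  have hy : ∀ x i, 0 ≤ v x i / 2 ^ E ∧ v x i / 2 ^ E < 1 := fun x i =>
    ⟨div_nonneg (hv x i).1 (by positivity), (div_lt_one (by positivity)).2 (hv x i).2⟩
  have h1 : Computes M w v 1 (fun x (p : Fin d × Fin 2) => ![v x (ι p.1) / 2 ^ E, c] p.2) := by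
    refine LayerTo.computes ?_ (by simp; omega)
    rintro ⟨i, k⟩
    fin_cases k
    · refine isNeuron_of_nonneg (fun x => (hy x _).1) (fun j => if j = ι i then 1 / 2 ^ E else 0) 0
        (fun j => ?_) (by simp; linarith) (fun x => ?_)
      · have : (1 : ℝ) / 2 ^ E ≤ 1 := div_le_one_of_le₀ (one_le_pow₀ one_le_two) (by positivity)
        have h0 : (0 : ℝ) ≤ 1 / 2 ^ E := by positivity
        split_ifs
        · rw [abs_of_nonneg h0]; linarith
        · simp; linarith
      · simp [div_eq_inv_mul]
    · exact isNeuron_of_nonneg (fun x => hc01.1) 0 c (fun j => by simp; linarith)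
        (by rw [abs_of_nonneg hc01.1]; linarith) (fun x => by simp)
  have h2 := (computes_readBits (X := X × Fin d) hM hs hsM t (fun p => v p.1 (ι p.2) / 2 ^ E) c
    (fun p => hy _ _) hc01 (fun p => hgood _ _)).parallel (X := X) (w' := w) (by linarith)
    (fun i x => (x, i)) (by simp; omega)
  have hpad : ∀ x (i : Fin d), pushBits t ⌊2 ^ t * (v x (ι i) / 2 ^ E)⌋₊ c =
      pushBits (t + r) (G x i) 0 := fun x i => by
    have h3 : G x i = fixedPoint t E (v x (ι i)) := hG x (ι i)
    rw [pushBits_add, h3, Nat.div_eq_of_lt (fixedPoint_lt (hv _ _).2), fixedPoint]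
  have h3 : Computes M w (fun x (p : Fin d × Fin 2) =>
      ![Int.fract (2 ^ t * (v x (ι p.1) / 2 ^ E)),
        pushBits t ⌊2 ^ t * (v x (ι p.1) / 2 ^ E)⌋₊ c] p.2) 1
      (fun x => ![stack (t + r) (G x) d]) := by
    refine LayerTo.computes (fun i => ?_) (by simpa using hw)
    fin_cases i
    refine isNeuron_of_nonneg (fun x => (stack_mem _ _ _).1)
      (fun p => if p.2 = 1 then 1 / (4 ^ (t + r)) ^ (d - 1 - p.1) else 0) 0
      (fun p => ?_) (by simp; linarith) (fun x => ?_)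
    · split_ifs
      · have h4 : (1 : ℝ) / (4 ^ (t + r)) ^ (d - 1 - p.1) ≤ 1 :=
          div_le_one_of_le₀ (one_le_pow₀ (one_le_pow₀ (by norm_num))) (by positivity)
        rw [abs_of_nonneg (by positivity)]
        linarith
      · simp; linarith
    · simp only [Fin.zero_eta, Matrix.cons_val_zero, stack_eq_sum, Finset.sum_range]
      rw [Fintype.sum_prod_type, add_zero]
      refine Finset.sum_congr rfl fun i _ => ?_
      rw [Fin.sum_univ_two]
      simp [hpad]
  rw [show t * 2 + 2 = 1 + t * 2 + 1 by ring]
  exact (h1.trans h2).trans h3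

end Input

/-! ### The narrow network -/

theorem ReLUNetwork.WeightsBoundedBy.mono {M M' : ℝ} (h : M ≤ M') {k : ℕ} {N : ReLUNetwork k}
    (hN : N.WeightsBoundedBy M) : N.WeightsBoundedBy M' := by
  induction N with
  | output W b => exact ⟨fun i j => (hN.1 i j).trans h, fun i => (hN.2 i).trans h⟩
  | hidden W b rest ih =>
    exact ⟨fun i j => (hN.1 i j).trans h, fun i => (hN.2.1 i).trans h, ih hN.2.2⟩

/-- Translating the input by `A` is absorbed by the biases of the first layer. -/
theorem ReLUNetwork.exists_shift {k : ℕ} (N : ReLUNetwork k) {n A B : ℝ} (hk : (k : ℝ) ≤ n)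
    (hA : 0 ≤ A) (hB : 0 ≤ B) (hN : N.WeightsBoundedBy B) :
    ∃ N' : ReLUNetwork k, N'.depth = N.depth ∧ N'.width = N.width ∧
      N'.WeightsBoundedBy ((n * A + 1) * B) ∧ ∀ x, N'.eval (fun i => x i + A) = N.eval x := by
  have hn : 0 ≤ n := (Nat.cast_nonneg k).trans hk
  have hBle : B ≤ (n * A + 1) * B := by nlinarith [mul_nonneg (mul_nonneg hn hA) hB]
  have hbias : ∀ {m : ℕ} (W : Matrix (Fin m) (Fin k) ℝ) (b : Fin m → ℝ), (∀ i j, |W i j| ≤ B) →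
      (∀ i, |b i| ≤ B) → ∀ i, |(b - W *ᵥ fun _ => A) i| ≤ (n * A + 1) * B := by
    intro m W b hW hb i
    have h1 : |∑ j, W i j * A| ≤ n * (B * A) := by
      calc |∑ j, W i j * A| ≤ ∑ j, |W i j * A| := Finset.abs_sum_le_sum_abs _ _
        _ ≤ ∑ _j : Fin k, B * A := Finset.sum_le_sum fun j _ => by
          rw [abs_mul, abs_of_nonneg hA]
          exact mul_le_mul_of_nonneg_right (hW i j) hA
        _ = k * (B * A) := by simp
        _ ≤ n * (B * A) := by gcongr
    have h2 : (b - W *ᵥ fun _ => A) i = b i - ∑ j, W i j * A := rfl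
    rw [h2]
    refine (abs_sub _ _).trans ?_
    linarith [hb i]
  have heval : ∀ {m : ℕ} (W : Matrix (Fin m) (Fin k) ℝ) (b : Fin m → ℝ) (x : Fin k → ℝ),
      W *ᵥ (fun i => x i + A) + (b - W *ᵥ fun _ => A) = W *ᵥ x + b := by
    intro m W b x
    have : (fun i => x i + A) = x + fun _ => A := rfl
    rw [this, Matrix.mulVec_add]
    abel
  cases N with
  | output W b =>
    refine ⟨.output W (b - W *ᵥ fun _ => A), rfl, rfl,
      ⟨fun i j => (hN.1 i j).trans hBle, hbias W b hN.1 hN.2⟩, fun x => ?_⟩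
    change (W *ᵥ (fun i => x i + A) + (b - W *ᵥ fun _ => A)) 0 = (W *ᵥ x + b) 0
    rw [heval]
  | hidden W b rest =>
    refine ⟨.hidden W (b - W *ᵥ fun _ => A) rest, rfl, rfl,
      ⟨fun i j => (hN.1 i j).trans hBle, hbias W b hN.1 hN.2.1, hN.2.2.mono hBle⟩, fun x => ?_⟩
    change rest.eval (fun i => max 0 ((W *ᵥ (fun i => x i + A) + (b - W *ᵥ fun _ => A)) i)) =
      rest.eval (fun i => max 0 ((W *ᵥ x + b) i))
    rw [heval]

/-- The padded first layer, which translates the input to the positive orthant. -/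
theorem ReLUNetwork.exists_translate {d m : ℕ} {A M : ℝ} (hA : 0 ≤ A) (hAM : A ≤ M) (hM : 1 ≤ M)
    (N : ReLUNetwork (Fintype.card (Fin m))) (hN : N.WeightsBoundedBy M) :
    ∃ N' : ReLUNetwork d, N'.width = max d N.width ∧ N'.depth = N.depth + 1 ∧
      N'.numParams = m * d + m + N.numParams ∧ N'.WeightsBoundedBy M ∧
      ∀ x : Fin d → ℝ, (∀ i, 0 ≤ x i + A) → N'.eval x =
        N.eval ((fun i : Fin m => if h : (i : ℕ) < d then x ⟨i, h⟩ + A else 0) ∘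
          (Fintype.equivFin (Fin m)).symm) := by
  let W : Matrix (Fin (Fintype.card (Fin m))) (Fin d) ℝ := fun i j =>
    if (((Fintype.equivFin (Fin m)).symm i : Fin m) : ℕ) = j then 1 else 0
  let b₀ : Fin (Fintype.card (Fin m)) → ℝ := fun i =>
    if (((Fintype.equivFin (Fin m)).symm i : Fin m) : ℕ) < d then A else 0
  refine ⟨.hidden W b₀ N, rfl, rfl, ?_, ⟨fun i j => ?_, fun i => ?_, hN⟩, fun x hx => ?_⟩
  · change Fintype.card (Fin m) * d + Fintype.card (Fin m) + N.numParams = _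
    have h1 : Fintype.card (Fin m) * d + Fintype.card (Fin m) = m * d + m := by
      rw [Fintype.card_fin]
    rw [h1]
  · simp only [W]
    split_ifs <;> simp <;> linarith
  · simp only [b₀]
    split_ifs
    · rwa [abs_of_nonneg hA]
    · simp; linarith
  · change N.eval _ = _
    congr 1
    funext i
    simp only [Function.comp, Pi.add_apply, Matrix.mulVec, dotProduct, W, b₀]
    generalize (Fintype.equivFin (Fin m)).symm i = k
    split_ifs with h
    · rw [Finset.sum_eq_single ⟨k, h⟩]
      · simpa using hx ⟨k, h⟩
      · intro j _ hj
        rw [if_neg (fun h' => hj (Fin.ext h'.symm)), zero_mul]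
      · simp
    · rw [Finset.sum_eq_zero]
      · simp
      · intro j _
        rw [if_neg (fun h' : (k : ℕ) = j => h (h' ▸ j.2)), zero_mul]

/-- The end of the network: undoing the normalization by `2 ^ E`, then the output layer. -/
theorem Computes.exists_readout {X κ : Type} [Fintype κ] {M b : ℝ} {D : ℕ} {φ : X → κ → ℝ}
    {a : X → Fin 2 → ℝ} (h : Computes M 10 φ D a) (hκ : Fintype.card κ ≤ 10) (hM : 2 ≤ M)
    (ha : ∀ x i, 0 ≤ a x i) (hb : |b| ≤ M) (E : ℕ) :
    ∃ N : ReLUNetwork (Fintype.card κ), N.depth = D + E + 1 ∧ N.WeightsBoundedBy M ∧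
      N.width ≤ 10 ∧ N.numParams ≤ (D + E) * 110 + 3 ∧
      ∀ x, N.eval (φ x ∘ (Fintype.equivFin κ).symm) = 2 ^ E * (a x 0 - a x 1) + b := by
  have hsim := h.trans (Computes.double (M := M) (w := 10) hM (by simp) ha E)
  have hout : (ReLUNetwork.output (k := Fintype.card (Fin 2))
      (fun _ j => ![1, -1] ((Fintype.equivFin (Fin 2)).symm j)) (fun _ => b)).WeightsBoundedBy
        M := by
    refine ⟨fun _ j => ?_, fun _ => hb⟩
    change |(![1, -1] : Fin 2 → ℝ) ((Fintype.equivFin (Fin 2)).symm j)| ≤ M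
    generalize (Fintype.equivFin (Fin 2)).symm j = k
    fin_cases k <;> simp <;> linarith
  obtain ⟨N, hd, hN, hw, hp, he⟩ := hsim.exists_network hκ _ hout
  refine ⟨N, hd, hN, hw, hp, fun x => ?_⟩
  rw [he]
  refine (congrArg (· + b) (Equiv.sum_comp (Fintype.equivFin (Fin 2)).symm
    (fun j => (![1, -1] : Fin 2 → ℝ) j * (2 ^ E * a x j)))).trans ?_
  simp [Fin.sum_univ_two]
  ring

/-- The bookkeeping of depth and number of parameters. -/
theorem narrow_counts {d n L T T₀ E D m : ℕ} (hn : 1 ≤ n) (hL : 1 ≤ L) (hdn : d ≤ n) (hT : 1 ≤ T)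
    (hT₀ : T₀ ≤ T) (hE : E ≤ T) (hD : D ≤ L * (16 * n ^ 2 * T)) (hm : m ≤ 10 * n) :
    T₀ * 2 + 2 + (D + E + 1) + 1 ≤ 23 * (L * n ^ 2 * T) ∧
    m * d + m + ((T₀ * 2 + 2) * (m * m + m) + ((D + E) * 110 + 3)) ≤ 2500 * (L * n ^ 2 * T) := by
  have hn2 : 1 ≤ n ^ 2 := Nat.one_le_pow _ _ hn
  have hP : n ^ 2 * T ≤ L * n ^ 2 * T := by
    rw [mul_assoc]; exact Nat.le_mul_of_pos_left _ hL
  have hP1 : n ^ 2 ≤ n ^ 2 * T := Nat.le_mul_of_pos_right _ hT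
  have hP2 : T ≤ n ^ 2 * T := Nat.le_mul_of_pos_left _ hn2
  have hD' : D ≤ 16 * (L * n ^ 2 * T) := hD.trans_eq (by ring)
  have h1 : m * d + m ≤ 20 * n ^ 2 := by
    calc m * d + m ≤ 10 * n * n + 10 * n := by gcongr
      _ ≤ 20 * n ^ 2 := by nlinarith
  have h2 : m * m + m ≤ 110 * n ^ 2 := by
    calc m * m + m ≤ 10 * n * (10 * n) + 10 * n := by gcongr
      _ ≤ 110 * n ^ 2 := by nlinarith
  have h3 : (T₀ * 2 + 2) * (m * m + m) ≤ 440 * (n ^ 2 * T) := by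
    calc (T₀ * 2 + 2) * (m * m + m) ≤ (4 * T) * (110 * n ^ 2) := Nat.mul_le_mul (by omega) h2
      _ = 440 * (n ^ 2 * T) := by ring
  constructor <;> omega

/-- The narrow network, which is correct at the points of the cube whose coordinates have readable
digits. The parameters are: `2 ^ r` bounds the growth per layer, `2 ^ F` the size of the
coordinates, and `2 ^ (-t)` the error. -/
theorem exists_narrow_network {d n L F r t : ℕ} {A B M s : ℝ} (N₀ : ReLUNetwork d) (hn : 1 ≤ n)
    (hwidth : N₀.width ≤ n) (hdepth : N₀.depth = L) (hN₀ : N₀.WeightsBoundedBy B)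
    (hA : 1 ≤ A) (hB : 1 ≤ B) (hr : 4 * n * ((n * A + 1) * B) ≤ 2 ^ r) (hF : 2 * A < 2 ^ F)
    (hM : 4 ≤ M) (hQM : (n * A + 1) * B + 1 ≤ M) (hs : 2 ≤ s) (hsM : s ≤ M) :
    ∃ N : ReLUNetwork d, N.width = max (5 * d) 10 ∧
      N.depth ≤ 23 * (L * n ^ 2 * (F + 2 * (L * r) + t)) ∧
      N.numParams ≤ 2500 * (L * n ^ 2 * (F + 2 * (L * r) + t)) ∧
      N.WeightsBoundedBy M ∧
      ∀ x ∈ centeredCube d A,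
        (∀ i, ReadableBits s (F + L * r + t) ((x i + A) / 2 ^ F)) →
        |N.eval x - N₀.eval x| ≤ 1 / 2 ^ t := by
  have hL : 1 ≤ L := hdepth ▸ N₀.one_le_depth
  have hdn : d ≤ n := N₀.le_width.trans hwidth
  have hn' : (1 : ℝ) ≤ n := by exact_mod_cast hn
  set Q : ℝ := (n * A + 1) * B with hQ
  have hQ1 : 1 ≤ Q := by
    have : 0 ≤ n * A := by positivity
    nlinarith
  obtain ⟨N₁, hd₁, hw₁, hW₁, he₁⟩ := N₀.exists_shift (n := n) (by exact_mod_cast hdn)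
    (by linarith : (0 : ℝ) ≤ A) (by linarith) hN₀
  set m := max (5 * d) 10 with hm
  have hm10 : 10 ≤ m := le_max_right _ _
  have hm5 : 5 * d ≤ m := le_max_left _ _
  set T := F + 2 * (L * r) + t with hT
  have hF1 : 1 ≤ F := by
    rcases Nat.eq_zero_or_pos F with h | h
    · rw [h, pow_zero] at hF; linarith
    · exact h
  have hT1 : 1 ≤ T := by omega
  have hTsplit : F + L * r + t + L * r = T := by omega
  let X := {x : Fin d → ℝ // x ∈ centeredCube d A ∧
    ∀ i, ReadableBits s (F + L * r + t) ((x i + A) / 2 ^ F)}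
  -- The registers after the first layer, padded with zeros to the required width.
  let v : X → Fin m → ℝ := fun x i => if h : (i : ℕ) < d then x.1 ⟨i, h⟩ + A else 0
  let G : X → ℕ → ℕ := fun x i =>
    fixedPoint (F + L * r + t) F (if h : i < d then x.1 ⟨i, h⟩ + A else 0)
  have hcoord : ∀ (x : X) i, 0 ≤ x.1 i + A ∧ x.1 i + A ≤ 2 * A := fun x i => by
    have h1 := x.2.1.1 i
    have h2 := x.2.1.2 i
    simp only at h1 h2
    constructor <;> linarith
  have hv : ∀ x i, 0 ≤ v x i ∧ v x i < 2 ^ F := fun x i => by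
    simp only [v]
    split_ifs with h
    · exact ⟨(hcoord x _).1, (hcoord x _).2.trans_lt hF⟩
    · exact ⟨le_rfl, by positivity⟩
  have hgood : ∀ x i, ReadableBits s (F + L * r + t) (v x i / 2 ^ F) := fun x i => by
    simp only [v]
    split_ifs with h
    · exact x.2.2 _
    · intro j _
      have : 1 / s ≤ 1 / 2 := by gcongr
      rw [zero_div, mul_zero, Int.fract_zero]
      exact fun h => by linarith [h.1]
  have hin := computes_input hM (by linarith) hsM hm5 (by omega) (F + L * r + t) (L * r) F v hv hgood
    G (fun x i => rfl)
  rw [hTsplit] at hin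
  set u : ℝ := 2 ^ (F + L * r) / 2 ^ T with hu
  have hu0 : 0 < u := by positivity
  have hGval : ∀ (x : X) (i : Fin d), G x i * u ≤ x.1 i + A ∧ x.1 i + A - G x i * u ≤ u := by
    intro x i
    have h1 : G x i = ⌊2 ^ (F + L * r + t) * ((x.1 i + A) / 2 ^ F)⌋₊ := by
      simp [G, fixedPoint]
    have h2 : x.1 i + A = 2 ^ (F + L * r + t) * ((x.1 i + A) / 2 ^ F) * u := by
      rw [hu, ← hTsplit]
      simp only [pow_add]
      field_simp
    have h3 : 0 ≤ 2 ^ (F + L * r + t) * ((x.1 i + A) / 2 ^ F) := by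
      have := (hcoord x i).1
      positivity
    have h4 := Nat.floor_le h3
    have h5 := Nat.lt_floor_add_one (2 ^ (F + L * r + t) * ((x.1 i + A) / 2 ^ F))
    rw [h1]
    constructor <;> nlinarith
  obtain ⟨a, b, D, hD, ha, hb, hDle, herr⟩ := N₁.exists_simulation (X := X) (E := F + L * r)
    (T := T) hn (hw₁.trans_le hwidth) hQ1 hW₁ hM hQM hr hT1 G
    (fun x i => x.1 i + A) u (2 * A) (fun x i => (hGval x i).1.trans (hcoord x i).2)
    (by linarith) (by
      rw [hd₁, hdepth, pow_add, mul_comm L r]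
      gcongr)
    (fun x i => by
      have := hGval x i
      rw [abs_le]; constructor <;> linarith)
    le_rfl
  rw [hd₁, hdepth] at hDle
  obtain ⟨N₂, hd₂, hM₂, hw₂, hp₂, he₂⟩ := hD.exists_readout (by simp) (by linarith) ha
    (by linarith) (F + L * r)
  obtain ⟨N₃, hd₃, hM₃, hw₃, hp₃, he₃⟩ := hin.exists_network (by simp) N₂ hM₂
  have hAM : A ≤ M := by
    have h1 : A ≤ n * A := le_mul_of_one_le_left (by linarith) hn'
    nlinarith
  obtain ⟨N₄, hw₄, hd₄, hp₄, hM₄, he₄⟩ := N₃.exists_translate (d := d) (by linarith) hAM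
    (by linarith) hM₃
  obtain ⟨hc₁, hc₂⟩ := narrow_counts (d := d) (T₀ := F + L * r + t) (E := F + L * r) (m := m) hn hL
    hdn hT1 (by omega) (by omega) hDle (by omega)
  have hm₃ : m ≤ N₃.width := by simpa only [Fintype.card_fin] using N₃.le_width
  refine ⟨N₄, ?_, ?_, ?_, hM₄, fun x hx hxg => ?_⟩
  · rw [hw₄, max_eq_right (by omega)]
    exact le_antisymm (hw₃.trans (max_le le_rfl (hw₂.trans hm10))) hm₃
  · rw [hd₄, hd₃, hd₂]
    exact hc₁
  · rw [hp₄]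
    exact le_trans (by gcongr; exact hp₃.trans (by gcongr)) hc₂
  · let x' : X := ⟨x, hx, hxg⟩
    have h1 : N₄.eval x = 2 ^ (F + L * r) * (a x' 0 - a x' 1) + b := by
      rw [he₄ x (fun i => (hcoord x' i).1)]
      exact (he₃ x').trans (he₂ x')
    rw [h1, ← he₁ x]
    refine (herr x').trans_eq ?_
    rw [hd₁, hdepth, hu, mul_comm r L, ← hTsplit]
    simp only [pow_add]
    field_simp

/-! ### The probability of misreading the input -/

/-- The points of `[-A, A]` of which some digit is misread have small measure: for each of the
`t` digits, they lie in intervals of total length at most `2 ^ F / s`. -/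
theorem volume_not_readable_le {A s : ℝ} (hs : 0 < s) {F : ℕ} (hF : 2 * A < 2 ^ F)
    (t : ℕ) :
    volume {v : ℝ | v ∈ Set.Icc (-A) A ∧ ¬ReadableBits s t ((v + A) / 2 ^ F)} ≤
      ENNReal.ofReal (t * (2 ^ F / s)) := by
  have hsub : {v : ℝ | v ∈ Set.Icc (-A) A ∧ ¬ReadableBits s t ((v + A) / 2 ^ F)} ⊆
      ⋃ j ∈ Finset.range t, ⋃ k ∈ Finset.range (2 ^ j),
        Set.Ioo ((k + 1 / 2 - 1 / s) * (2 ^ F / 2 ^ j) - A)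
          ((k + 1 / 2) * (2 ^ F / 2 ^ j) - A) := by
    rintro v ⟨hv, hbad⟩
    simp only [ReadableBits, not_forall, not_not] at hbad
    obtain ⟨j, hj, h1, h2⟩ := hbad
    set y := (v + A) / 2 ^ F with hy
    have hy0 : 0 ≤ y := div_nonneg (by linarith [hv.1]) (by positivity)
    have hy1 : y < 1 := (div_lt_one (by positivity)).2 (by linarith [hv.2])
    have hpos : (0 : ℝ) < 2 ^ F / 2 ^ j := by positivity
    have hvy : v = 2 ^ j * y * (2 ^ F / 2 ^ j) - A := by
      rw [hy]; field_simp; ring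
    have h3 : (2 : ℝ) ^ j * y = ⌊2 ^ j * y⌋₊ + Int.fract (2 ^ j * y) := by
      rw [natCast_floor_eq_intCast_floor (by positivity)]
      exact (Int.floor_add_fract _).symm
    have h4 : ⌊2 ^ j * y⌋₊ < 2 ^ j := by
      rw [Nat.floor_lt (by positivity)]
      push_cast
      have : (0 : ℝ) < 2 ^ j := by positivity
      nlinarith
    simp only [Set.mem_iUnion, Finset.mem_range]
    refine ⟨j, hj, ⌊2 ^ j * y⌋₊, h4, ?_, ?_⟩
    · rw [hvy]
      have : (⌊2 ^ j * y⌋₊ + 1 / 2 - 1 / s) < 2 ^ j * y := by linarith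
      have := mul_lt_mul_of_pos_right this hpos
      linarith
    · rw [hvy]
      have : 2 ^ j * y < (⌊2 ^ j * y⌋₊ + 1 / 2 : ℝ) := by linarith
      have := mul_lt_mul_of_pos_right this hpos
      linarith
  refine (measure_mono hsub).trans ?_
  refine (measure_biUnion_finset_le _ _).trans ?_
  have h5 : ∀ j ∈ Finset.range t, volume (⋃ k ∈ Finset.range (2 ^ j),
      Set.Ioo ((k + 1 / 2 - 1 / s) * (2 ^ F / 2 ^ j) - A) ((k + 1 / 2) * (2 ^ F / 2 ^ j) - A)) ≤
      ENNReal.ofReal (2 ^ F / s) := by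
    intro j _
    refine (measure_biUnion_finset_le _ _).trans ?_
    have h6 : ∀ k ∈ Finset.range (2 ^ j), volume (Set.Ioo
        (((k : ℝ) + 1 / 2 - 1 / s) * (2 ^ F / 2 ^ j) - A)
        ((k + 1 / 2) * (2 ^ F / 2 ^ j) - A)) = ENNReal.ofReal (2 ^ F / s / 2 ^ j) := by
      intro k _
      rw [Real.volume_Ioo]
      congr 1
      field_simp
      ring
    rw [Finset.sum_congr rfl h6, Finset.sum_const, Finset.card_range, ← ENNReal.ofReal_nsmul]
    apply ENNReal.ofReal_le_ofReal
    rw [nsmul_eq_mul]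
    push_cast
    rw [mul_div_cancel₀]
    positivity
  refine (Finset.sum_le_sum h5).trans ?_
  rw [Finset.sum_const, Finset.card_range, ← ENNReal.ofReal_nsmul, nsmul_eq_mul]

theorem volume_centeredCube_inter_le {d : ℕ} {A b : ℝ} (hA : 0 ≤ A) (i : Fin d) (S : Set ℝ)
    (hS : volume {v | v ∈ Set.Icc (-A) A ∧ v ∈ S} ≤ ENNReal.ofReal (2 * A * b)) :
    volume {x | x ∈ centeredCube d A ∧ x i ∈ S} ≤ ENNReal.ofReal ((2 * A) ^ d * b) := by
  classical
  have hsub : {x | x ∈ centeredCube d A ∧ x i ∈ S} ⊆ Set.univ.pi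
      (Function.update (fun _ => Set.Icc (-A) A) i {v | v ∈ Set.Icc (-A) A ∧ v ∈ S}) := by
    rintro x ⟨hx, hxi⟩ j _
    have hxj : x j ∈ Set.Icc (-A) A := ⟨hx.1 j, hx.2 j⟩
    rcases eq_or_ne j i with rfl | h
    · rw [Function.update_self]
      exact ⟨hxj, hxi⟩
    · rw [Function.update_of_ne h]
      exact hxj
  refine (measure_mono hsub).trans ?_
  rw [volume_pi_pi]
  have h1 : ∀ j, volume (Function.update (fun _ : Fin d => Set.Icc (-A) A) i
      {v | v ∈ Set.Icc (-A) A ∧ v ∈ S} j) = Function.update (fun _ => ENNReal.ofReal (2 * A)) i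
        (volume {v | v ∈ Set.Icc (-A) A ∧ v ∈ S}) j := by
    intro j
    rcases eq_or_ne j i with rfl | h
    · rw [Function.update_self, Function.update_self]
    · rw [Function.update_of_ne h, Function.update_of_ne h, Real.volume_Icc]
      congr 1
      ring
  rw [Finset.prod_congr rfl (fun j _ => h1 j), Finset.prod_update_of_mem (Finset.mem_univ i),
    Finset.prod_const, Finset.card_sdiff_of_subset (by simp), Finset.card_univ, Fintype.card_fin,
    Finset.card_singleton, ← ENNReal.ofReal_pow (by positivity)]
  calc _ ≤ ENNReal.ofReal (2 * A * b) * ENNReal.ofReal ((2 * A) ^ (d - 1)) := by gcongr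
    _ = ENNReal.ofReal ((2 * A) ^ d * b) := by
      rw [mul_comm, ← ENNReal.ofReal_mul (by positivity)]
      congr 1
      have hd : d = d - 1 + 1 := by have := i.2; omega
      conv_rhs => rw [hd, pow_succ]
      ring

/-- The measure of a set is at most the bound of the density times its volume in the cube. -/
theorem measure_le_of_density_le {d : ℕ} {A β : ℝ} (μ : Measure (Fin d → ℝ))
    (p : (Fin d → ℝ) → ℝ≥0∞) (hμ : μ = (volume.restrict (centeredCube d A)).withDensity p)
    (hp : ∀ x ∈ centeredCube d A, p x ≤ ENNReal.ofReal β)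
    (S : Set (Fin d → ℝ)) :
    μ S ≤ ENNReal.ofReal β * volume (S ∩ centeredCube d A) := by
  have hmeas : MeasurableSet (centeredCube d A) := measurableSet_Icc
  have h1 : μ ≤ ENNReal.ofReal β • volume.restrict (centeredCube d A) := by
    rw [hμ, ← withDensity_const]
    exact withDensity_mono ((ae_restrict_iff' hmeas).2 (Filter.Eventually.of_forall hp))
  refine (h1 S).trans_eq ?_
  rw [Measure.smul_apply, Measure.restrict_apply' hmeas, smul_eq_mul]

/-- A density that is bounded by `β` forces `β` to be at least the inverse of the volume. -/
theorem one_le_density_bound_mul {d : ℕ} {A β : ℝ} (μ : Measure (Fin d → ℝ))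
    [IsProbabilityMeasure μ] (p : (Fin d → ℝ) → ℝ≥0∞) (hμ : μ = (volume.restrict (centeredCube d A)).withDensity p)
    (hp : ∀ x ∈ centeredCube d A, p x ≤ ENNReal.ofReal β)
    (hA : 0 ≤ A) (hβ : 0 < β) : 1 ≤ β * (2 * A) ^ d := by
  have h1 := measure_le_of_density_le μ p hμ hp Set.univ
  rw [measure_univ, Set.univ_inter, centeredCube, Real.volume_Icc_pi] at h1
  simp only [sub_neg_eq_add, Finset.prod_const, Finset.card_univ, Fintype.card_fin] at h1
  rw [← ENNReal.ofReal_pow (by linarith), ← ENNReal.ofReal_mul hβ.le, ← ENNReal.ofReal_one,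
    ENNReal.ofReal_le_ofReal_iff (by positivity), ← two_mul] at h1
  exact h1

/-- With weights of the stated size, all coordinates are read correctly with probability more than
`1 - δ`. -/
theorem lt_measureReal_of_readable {d : ℕ} {A β : ℝ} (μ : Measure (Fin d → ℝ))
    [IsProbabilityMeasure μ] (p : (Fin d → ℝ) → ℝ≥0∞) (hμ : μ = (volume.restrict (centeredCube d A)).withDensity p)
    (hp : ∀ x ∈ centeredCube d A, p x ≤ ENNReal.ofReal β)
    {δ s : ℝ} (hA : 1 ≤ A) (hβ : 0 < β) (hδ : 0 < δ) (hs : 0 < s)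
    {F t : ℕ} (hF : 2 * A < 2 ^ F) (hF' : 2 ^ F ≤ 4 * A)
    (hst : s * δ = 4 * d * t * β * (2 * A) ^ d) (S : Set (Fin d → ℝ))
    (hS : ∀ x ∈ centeredCube d A, (∀ i, ReadableBits s t ((x i + A) / 2 ^ F)) → x ∈ S) :
    1 - δ < μ.real S := by
  have h1 : volume (Sᶜ ∩ centeredCube d A) ≤ ENNReal.ofReal (d * ((2 * A) ^ d * (2 * t / s))) := by
    have hsub : Sᶜ ∩ centeredCube d A ⊆ ⋃ i ∈ (Finset.univ : Finset (Fin d)),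
        {x | x ∈ centeredCube d A ∧ x i ∈ {v | ¬ReadableBits s t ((v + A) / 2 ^ F)}} := by
      rintro x ⟨hxS, hx⟩
      by_contra h
      simp only [Set.mem_iUnion, not_exists, Set.mem_ofPred_eq, not_and, not_not] at h
      exact hxS (hS x hx fun i => h i (Finset.mem_univ i) hx)
    refine (measure_mono hsub).trans ((measure_biUnion_finset_le _ _).trans ?_)
    refine (Finset.sum_le_sum fun i _ => volume_centeredCube_inter_le (by linarith) i _
      ((volume_not_readable_le hs hF t).trans
        (ENNReal.ofReal_le_ofReal (?_ : _ ≤ 2 * A * (2 * t / s))))).trans ?_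
    · calc (t : ℝ) * (2 ^ F / s) ≤ t * (4 * A / s) := by gcongr
        _ = 2 * A * (2 * t / s) := by ring
    · rw [Finset.sum_const, Finset.card_univ, Fintype.card_fin, ← ENNReal.ofReal_nsmul,
        nsmul_eq_mul]
  have h2 : μ Sᶜ ≤ ENNReal.ofReal (δ / 2) := by
    refine (measure_le_of_density_le μ p hμ hp _).trans ?_
    calc ENNReal.ofReal β * volume (Sᶜ ∩ centeredCube d A)
        ≤ ENNReal.ofReal β * ENNReal.ofReal (d * ((2 * A) ^ d * (2 * t / s))) := by gcongr
      _ = ENNReal.ofReal (δ / 2) := by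
        rw [← ENNReal.ofReal_mul hβ.le]
        congr 1
        field_simp
        linarith
  have h3 : μ.real Sᶜ ≤ δ / 2 := ENNReal.toReal_le_of_le_ofReal (by positivity) h2
  have h4 : μ.real (S ∪ Sᶜ) ≤ μ.real S + μ.real Sᶜ := measureReal_union_le _ _
  rw [Set.union_compl_self, probReal_univ] at h4
  linarith

/-! ### The choice of the parameters -/

theorem exists_two_pow_near {x : ℝ} (hx : 1 ≤ x) : ∃ k : ℕ, x < 2 ^ k ∧ 2 ^ k ≤ 2 * x := by
  obtain ⟨k, h1, h2⟩ := exists_nat_pow_near hx one_lt_two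
  exact ⟨k + 1, h2, by rw [pow_succ]; linarith⟩

theorem exists_parameters {A B n ε : ℝ} (hA : 1 ≤ A) (hB : 1 ≤ B) (hn : 1 ≤ n) (hε : 0 < ε)
    (hε' : ε ≤ 1 / 2) :
    ∃ r F t : ℕ, 4 * n * ((n * A + 1) * B) ≤ 2 ^ r ∧ 2 * A < 2 ^ F ∧ 2 ^ F ≤ 4 * A ∧
      1 / 2 ^ t ≤ ε ∧
      ∀ L : ℕ, 1 ≤ L → ((F + 2 * (L * r) + t : ℕ) : ℝ) ≤ 36 * L * Real.log (A * B * n / ε) := by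
  have hAn : 1 ≤ n * A := one_le_mul_of_one_le_of_one_le hn hA
  have hAB : 1 ≤ A * B := one_le_mul_of_one_le_of_one_le hA hB
  have hABn : 1 ≤ A * B * n := one_le_mul_of_one_le_of_one_le hAB hn
  set P := A * B * n / ε with hP
  have hε1 : 2 ≤ 1 / ε := by rw [le_div_iff₀ hε]; linarith
  have hPe : P = A * B * n * (1 / ε) := by rw [hP]; ring
  have hP2 : 2 ≤ P := by rw [hPe]; nlinarith
  have hPP : A * B * n ≤ P := by rw [hPe]; nlinarith
  have hPε : 1 / ε ≤ P := by rw [hPe]; nlinarith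
  have hAP : A ≤ P := by
    refine le_trans ?_ hPP
    rw [mul_assoc]
    exact le_mul_of_one_le_right (by linarith) (one_le_mul_of_one_le_of_one_le hB hn)
  have hnP : n ≤ P := (le_mul_of_one_le_left (by linarith) hAB).trans hPP
  have hR1 : 1 ≤ 4 * n * ((n * A + 1) * B) := by
    have h1 : 1 ≤ (n * A + 1) * B := one_le_mul_of_one_le_of_one_le (by linarith) hB
    nlinarith
  obtain ⟨r, hr, hr'⟩ := exists_two_pow_near hR1
  obtain ⟨F, hF, hF'⟩ := exists_two_pow_near (by linarith : (1 : ℝ) ≤ 2 * A)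
  obtain ⟨t, ht, ht'⟩ := exists_two_pow_near (by linarith : (1 : ℝ) ≤ 1 / ε)
  have hlog : ∀ {k m : ℕ}, (2 : ℝ) ^ k ≤ P ^ m → (k : ℝ) ≤ 2 * m * Real.log P := by
    intro k m h
    have h1 := Real.log_le_log (by positivity) h
    rw [Real.log_pow, Real.log_pow] at h1
    have h2 := Real.log_two_gt_d9
    have h3 : (0 : ℝ) ≤ k := Nat.cast_nonneg k
    nlinarith
  have hr6 : (r : ℝ) ≤ 2 * (6 : ℕ) * Real.log P := hlog <| by
    calc (2 : ℝ) ^ r ≤ 2 * (4 * n * ((n * A + 1) * B)) := hr'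
      _ ≤ 2 * (4 * n * ((n * A + n * A) * B)) := by gcongr
      _ = 2 ^ 4 * (n * (A * B * n)) := by ring
      _ ≤ P ^ 4 * (P * P) := by gcongr
      _ = P ^ 6 := by ring
  have hF3 : (F : ℝ) ≤ 2 * (3 : ℕ) * Real.log P := hlog <| by
    calc (2 : ℝ) ^ F ≤ 2 * (2 * A) := hF'
      _ = 2 * 2 * A := by ring
      _ ≤ P * P * P := by gcongr
      _ = P ^ 3 := by ring
  have ht2 : (t : ℝ) ≤ 2 * (2 : ℕ) * Real.log P := hlog <| by
    calc (2 : ℝ) ^ t ≤ 2 * (1 / ε) := ht'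
      _ ≤ P * P := by gcongr
      _ = P ^ 2 := by ring
  refine ⟨r, F, t, hr.le, hF, by linarith, ?_, fun L hL => ?_⟩
  · rw [div_le_iff₀ (by positivity), mul_comm, ← div_le_iff₀ hε]
    exact ht.le
  · have hL' : (1 : ℝ) ≤ L := by exact_mod_cast hL
    have hΛ : 0 ≤ Real.log P := Real.log_nonneg (by linarith)
    have h1 : Real.log P ≤ L * Real.log P := le_mul_of_one_le_left hΛ hL'
    push_cast at hr6 hF3 ht2 ⊢
    have h2 : (L : ℝ) * r ≤ L * (2 * 6 * Real.log P) := by gcongr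
    linarith

/-- A network of the required size with all weights zero. -/
theorem exists_zero_network (d : ℕ) : ∃ N : ReLUNetwork d, N.width = max (5 * d) 10 ∧
    N.depth = 2 ∧ N.numParams ≤ 10 * (d + 2) ^ 2 ∧ N.WeightsBoundedBy 0 := by
  refine ⟨.hidden (m := max (5 * d) 10) 0 0 (.output 0 0), ?_, rfl, ?_, ?_⟩
  · change max d (max (5 * d) 10) = _
    omega
  · change max (5 * d) 10 * d + max (5 * d) 10 + (1 * max (5 * d) 10 + 1) ≤ _
    have h1 : max (5 * d) 10 ≤ 5 * d + 10 := by omega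
    calc _ ≤ (5 * d + 10) * d + (5 * d + 10) + (1 * (5 * d + 10) + 1) := by gcongr
      _ ≤ 10 * (d + 2) ^ 2 := by nlinarith
  · exact ⟨by simp, by simp, by simp, by simp⟩

/-- The allowed size of weights suffices for all weights of the construction, in particular for
the slope `s` with which the digits of the input are read. Here `P` stands for `n * A * B / ε` and
`κ` for `β * (2 * A) ^ d / δ`. -/
theorem weight_estimates {A B n L d P κ T W : ℝ} (hA : 1 ≤ A) (hB : 1 ≤ B) (hn : 1 ≤ n)
    (hL : 1 ≤ L) (hd : 1 ≤ d) (hP : 1 ≤ P) (hABn : A * B * n ≤ P) (hκ : 1 ≤ κ) (hT : 1 ≤ T)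
    (hT' : T ≤ 36 * L * P) (hW : L ≤ W) :
    4 ≤ 100000 * (W * d ^ 2 * P * κ) ∧ (n * A + 1) * B + 1 ≤ 100000 * (W * d ^ 2 * P * κ) ∧
    2 ≤ 4 * d * T * κ ∧ 4 * d * T * κ ≤ 100000 * (W * d ^ 2 * P * κ) := by
  have hdd : d ≤ d ^ 2 := by nlinarith
  have h1 : 1 ≤ W * d ^ 2 := one_le_mul_of_one_le_of_one_le (hL.trans hW) (hd.trans hdd)
  have h2 : P ≤ W * d ^ 2 * P := le_mul_of_one_le_left (by linarith) h1
  have h3 : W * d ^ 2 * P ≤ W * d ^ 2 * P * κ := le_mul_of_one_le_right (by linarith) hκ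
  have hBn : B ≤ A * B * n := by
    calc B ≤ (A * n) * B :=
        le_mul_of_one_le_left (by linarith) (one_le_mul_of_one_le_of_one_le hA hn)
      _ = A * B * n := by ring
  have h4 : (n * A + 1) * B = A * B * n + B := by ring
  have h5 : 1 ≤ d * T * κ :=
    one_le_mul_of_one_le_of_one_le (one_le_mul_of_one_le_of_one_le hd hT) hκ
  refine ⟨by linarith, by linarith, by linarith, ?_⟩
  calc 4 * d * T * κ ≤ 4 * d ^ 2 * (36 * W * P) * κ := by
        gcongr
        exact hT'.trans (by gcongr)
    _ = 144 * (W * d ^ 2 * P * κ) := by ring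
    _ ≤ 100000 * (W * d ^ 2 * P * κ) := by gcongr; norm_num

theorem theorem3p1 :
    ∃ C : ℝ, 0 < C ∧
      ∀ (A B n L d : ℕ), 1 ≤ A → 1 ≤ B → 1 ≤ n → 1 ≤ L → 1 ≤ d →
      ∀ (ε δ β : ℝ), 0 < ε → 0 < δ → 0 < β →
      ∀ N₀ : ReLUNetwork d, N₀.width = n → N₀.depth = L → N₀.WeightsBoundedBy (B : ℝ) →
      ∀ (μ : Measure (Fin d → ℝ)) [IsProbabilityMeasure μ] (p : (Fin d → ℝ) → ℝ≥0∞),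
        Measurable p →
        μ = (volume.restrict (centeredCube d (A : ℝ))).withDensity p →
        (∀ x ∈ centeredCube d (A : ℝ), p x ≤ ENNReal.ofReal β) →
      ∃ N : ReLUNetwork d,
        N.width = max (5 * d) 10 ∧
        (N.depth : ℝ) ≤
          C * ((n : ℝ) ^ 2 * (L : ℝ) ^ 2 * Real.log ((A : ℝ) * B * n / min ε (1 / 2))) ∧
        (N.numParams : ℝ) ≤
          C * ((n : ℝ) ^ 2 * (L : ℝ) ^ 2 * Real.log ((A : ℝ) * B * n / min ε (1 / 2))) ∧
        N.WeightsBoundedBy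
          (C * ((2 : ℝ) ^ (6 * L * n) * (d : ℝ) ^ 2 * n * A * B * β * (2 * (A : ℝ)) ^ d /
            (min ε (1 / 2) * δ))) ∧
        1 - δ < μ.real {x | |N.eval x - N₀.eval x| ≤ ε} := by
  refine ⟨100000, by norm_num, ?_⟩
  intro A B n L d hA hB hn hL hd ε δ β hε hδ hβ N₀ hwidth hdepth hN₀ μ _ p _ hμ hp
  have hdn : d ≤ n := hwidth ▸ N₀.le_width
  set ε₀ := min ε (1 / 2) with hε₀
  have hε₀0 : 0 < ε₀ := lt_min hε (by norm_num)
  have hε₀1 : ε₀ ≤ 1 / 2 := min_le_right _ _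
  have hA' : (1 : ℝ) ≤ A := by exact_mod_cast hA
  have hB' : (1 : ℝ) ≤ B := by exact_mod_cast hB
  have hn' : (1 : ℝ) ≤ n := by exact_mod_cast hn
  have hL' : (1 : ℝ) ≤ L := by exact_mod_cast hL
  have hd' : (1 : ℝ) ≤ d := by exact_mod_cast hd
  obtain ⟨r, F, t, hr, hF, hF', ht, hT⟩ := exists_parameters hA' hB' hn' hε₀0 hε₀1
  replace hT := hT L hL
  set P : ℝ := (A : ℝ) * B * n / ε₀ with hP
  set T : ℕ := F + 2 * (L * r) + t with hTdef
  have hABn : (1 : ℝ) ≤ A * B * n := by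
    exact_mod_cast Nat.mul_pos (Nat.mul_pos hA hB) hn
  have hPe : P = A * B * n * (1 / ε₀) := by rw [hP]; ring
  have hε1 : 2 ≤ 1 / ε₀ := by rw [le_div_iff₀ hε₀0]; linarith
  have hP2 : 2 ≤ P := by rw [hPe]; nlinarith
  have hPP : A * B * n ≤ P := by rw [hPe]; nlinarith
  have hF1 : 1 ≤ F := by
    rcases Nat.eq_zero_or_pos F with h | h
    · rw [h, pow_zero] at hF; linarith
    · exact h
  have hT1 : (1 : ℝ) ≤ T := by
    have : 1 ≤ T := by omega
    exact_mod_cast this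
  have hΛ : 0 ≤ Real.log P := Real.log_nonneg (by linarith)
  have hcount : ∀ {c m : ℕ}, c ≤ 2500 → m ≤ c * (L * n ^ 2 * T) →
      (m : ℝ) ≤ 100000 * ((n : ℝ) ^ 2 * (L : ℝ) ^ 2 * Real.log P) := by
    intro c m hc hm
    have h1 : (m : ℝ) ≤ c * (L * n ^ 2 * T) := by exact_mod_cast hm
    have h2 : (c : ℝ) ≤ 2500 := by exact_mod_cast hc
    calc (m : ℝ) ≤ c * (L * n ^ 2 * T) := h1
      _ ≤ 2500 * (L * n ^ 2 * (36 * L * Real.log P)) := by gcongr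
      _ = 90000 * ((n : ℝ) ^ 2 * (L : ℝ) ^ 2 * Real.log P) := by ring
      _ ≤ _ := by gcongr; norm_num
  rcases lt_or_ge 1 δ with hδ1 | hδ1
  · -- Any network will do: the lower bound for the probability is negative.
    obtain ⟨N, h1, h2, h3, h4⟩ := exists_zero_network d
    have hT1' : 1 ≤ T := by exact_mod_cast hT1
    have hn2 : n ^ 2 ≤ L * n ^ 2 * T := by
      calc n ^ 2 = 1 * n ^ 2 * 1 := by ring
        _ ≤ L * n ^ 2 * T := by gcongr
    have hn1 : 1 ≤ n ^ 2 := Nat.one_le_pow _ _ hn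
    refine ⟨N, h1, hcount (c := 2500) le_rfl (by rw [h2]; omega),
      hcount (c := 2500) le_rfl (h3.trans ?_), h4.mono (by positivity), ?_⟩
    · calc 10 * (d + 2) ^ 2 ≤ 10 * (n + 2 * n) ^ 2 := by gcongr; omega
        _ = 90 * n ^ 2 := by ring
        _ ≤ 2500 * (L * n ^ 2 * T) := by omega
    · have : 0 ≤ μ.real {x | |N.eval x - N₀.eval x| ≤ ε} := measureReal_nonneg
      linarith
  · have hK : 1 ≤ β * (2 * (A : ℝ)) ^ d := one_le_density_bound_mul μ p hμ hp (by linarith) hβ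
    have hκ : 1 ≤ β * (2 * (A : ℝ)) ^ d / δ := by rw [le_div_iff₀ hδ]; linarith
    have hpow : (L : ℝ) ≤ 2 ^ (6 * L * n) := by
      have h1 : L ≤ 2 ^ (6 * L * n) := by
        calc L ≤ L * (6 * n) := Nat.le_mul_of_pos_right _ (by omega)
          _ = 6 * L * n := by ring
          _ ≤ 2 ^ (6 * L * n) := Nat.lt_two_pow_self.le
      exact_mod_cast h1
    have hT0 : ((F + L * r + t : ℕ) : ℝ) ≤ T := by
      have h1 : F + L * r + t ≤ T := by omega
      exact_mod_cast h1
    have hT0' : ((F + L * r + t : ℕ) : ℝ) ≤ 36 * L * P := by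
      have h2 : Real.log P ≤ P := (Real.log_le_sub_one_of_pos (by linarith)).trans (by linarith)
      exact (hT0.trans hT).trans (by gcongr)
    have hT0one : (1 : ℝ) ≤ ((F + L * r + t : ℕ) : ℝ) := by
      have : 1 ≤ F + L * r + t := by omega
      exact_mod_cast this
    obtain ⟨h4M, hQM, hs2, hsM⟩ := weight_estimates hA' hB' hn' hL' hd' (by linarith : 1 ≤ P) hPP hκ
      hT0one hT0' hpow
    have hMe : 100000 * ((2 : ℝ) ^ (6 * L * n) * (d : ℝ) ^ 2 * n * A * B * β * (2 * (A : ℝ)) ^ d /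
        (ε₀ * δ)) =
        100000 * (2 ^ (6 * L * n) * (d : ℝ) ^ 2 * P * (β * (2 * (A : ℝ)) ^ d / δ)) := by
      rw [hP]
      field_simp
    rw [hMe]
    obtain ⟨N, h1, h2, h3, h4, h5⟩ := exists_narrow_network (t := t) N₀ hn hwidth.le hdepth hN₀ hA'
      hB' hr hF h4M hQM hs2 hsM
    refine ⟨N, h1, hcount (by norm_num) h2, hcount le_rfl h3, h4, ?_⟩
    refine lt_measureReal_of_readable μ p hμ hp hA' hβ hδ (by linarith) hF hF' ?_ _
      (fun x hx hxg => (h5 x hx hxg).trans (ht.trans (min_le_left _ _)))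
    field_simp
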